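/- **Setting.** Let $\mathcal G$ be a groupoid with unit space $X$, target and source maps $t,s:\mathcal G\to X$ and fibres $\mathcal G^x=t^{-1}(x)$, where $X$ and $\mathcal G$ are standard Borel and all structure maps are Borel. It is a *measured groupoid* if it carries a probability measure $\mu$ on $X$ and a left-invariant Borel Haar system $\rho=(\rho^x)_{x\in X}$ of $\sigma$-finite measures on the fibres $\mathcal G^x$ such that the class of $\rho\circ\mu=\int_X\rho^x\,d\mu(x)$ is preserved by inversion; it is also equipped with a measurable family of probability measures $\nu^x\sim\rho^x$ on $\mathcal G^x$ ($x \in X$), and $\nu:=\int_X\nu^x\,d\mu(x)\sim\rho\circ\mu$. It is *$t$-discrete* if every $\mathcal G^x$ is countable and every $\rho^x$ is the counting measure. It is *amenable* if there are linear functionals $\mathfrak m^x:L^\infty(\mathcal G^x,\nu^x)\to\mathbb R$ $(x\in X)$ of norm one with $\mathfrak m^x(1)=1$, such that $x\mapsto\mathfrak m^x(\varphi|_{\mathcal G^x})$ is $\mu$-measurable for every bounded Borel $\varphi:\mathcal G\to\mathbb R$, and such that for $\nu$-almost every $g$ one has $\mathfrak m^{t(g)}(\lambda)=\mathfrak m^{s(g)}(h\mapsto\lambda(gh))$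 for all $\lambda\in L^\infty(\mathcal G^{t(g)},\nu^{t(g)})$. A *measurable bundle* $\mathcal F$ over $(X,\mu)$ is a family of Banach spaces $(F_x)_{x\in X}$ (over $\mathbb R$ or $\mathbb C$) with a set of vector fields, called measurable sections, that is closed under sums, under multiplication by $\mu$-measurable scalar functions and under almost everywhere limits of sequences, and whose members $\sigma$ have $\mu$-measurable norm $x\mapsto\|\sigma(x)\|$. It is *separable* if some sequence of measurable sections is dense in $F_x$ for almost every $x$. The measurable structure *generated* by a set of vector fields is the smallest set containing it with these closure properties; the pullback $p^*\mathcal F$ along a Borel map $p$ has the structure generated by the $\sigma\circ p$. A *measurable $\mathcal G$-bundle* is a measurable bundle with an action of $\mathcal G$ by linear isometries $L(g):F_{s(g)}\to F_{t(g)}$ such that $g\mapsto L(g)\sigma(s(g))$ is a measurable section of $t^*\mathcal F$ over $(\mathcal G,\nu)$ for every measurable section $\sigma$. The *dual* $\mathcal E=\mathcal F^*$ of a separable measurable $\mathcal G$-bundle $\mathcal F$ has fibres $E_x=F_x^*$, measurable sections those $\eta$ for which $x\mapsto\langle\eta(x),\sigma(x)\rangle$ is $\mu$-measurable for every measurable section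 $\sigma$ of $\mathcal F$, and action $\langle L^*(g)\theta,v\rangle=\langle\theta,L(g)^{-1}v\rangle$. For $n\ge1$ let $\mathcal G^{(n)}$ be the $n$-fold fibred product of $\mathcal G$ over $t$, with the measure $\int_X(\nu^x)^{\otimes n}\,d\mu(x)$ and the projection $t^{(n)}:\mathcal G^{(n)}\to X$. The bundle $x\mapsto L^1\big(((\mathcal G^x)^n,(\nu^x)^{\otimes n}),F_x\big)$ has the measurable structure generated by the sections of $(t^{(n)})^*\mathcal F$ that are integrable on $(\mathcal G^x)^n$ for almost every $x$, and $\mathcal L(\mathcal G^{(n)},\mathcal E):x\mapsto L^\infty_{\mathrm w^*}\big(((\mathcal G^x)^n,(\nu^x)^{\otimes n}),E_x\big)$ (classes of weak-* measurable essentially bounded functions) has the dual measurable structure and the action $(\overline L(g)\lambda)(g_0,\dots,g_{n-1})=L^*(g)\lambda(g^{-1}g_0,\dots,g^{-1}g_{n-1})$. Let $L^\infty(X,\mathcal L(\mathcal G^{(k+1)},\mathcal E))^{\mathcal G}$ be the space of essentially bounded measurable sections $f$, up to equality almost everywhere, with $\overline L(g)f(s(g))=f(t(g))$ for $\nu$-almost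 every $g$. With the coboundary $$(d^kf)(x)(g_0,\dots,g_{k+1})=\sum_{i=0}^{k+1}(-1)^i f(x)(g_0,\dots,\widehat{g_i},\dots,g_{k+1})$$ these spaces form a complex in degrees $k\ge0$, and $\mathrm H^k_{\mathrm{mb}}(\mathcal G,\mathcal E)$ is its $k$-th cohomology. **Corollary B.** Let $\mathcal G$ be a $t$-discrete amenable measured groupoid and let $\mathcal E$ be the dual of a separable measurable $\mathcal G$-bundle. Then $\mathrm H^k_{\mathrm{mb}}(\mathcal G,\mathcal E)=0$ for every $k\ge1$. -/

import Mathlib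

open MeasureTheory Filter Topology CategoryTheory
open scoped ENNReal

universe u v w

namespace BddGroupoid

/-! ### Borel groupoids -/

section Groupoids

/-- The space of morphisms of a groupoid with set of objects `X`; the morphism `g : src ⟶ tgt`
has source `src` and target `tgt`. -/
structure Arr (X : Type u) [Groupoid.{v} X] where
  src : X
  tgt : X
  hom : src ⟶ tgt

/-- Pairs `(g, h)` of morphisms with `s(g) = t(h)`. -/
structure Composable (X : Type u) [Groupoid.{v} X] where
  {x y z : X}
  left : y ⟶ z
  right : x ⟶ y

variable {X : Type u} [Groupoid.{v} X]

/-- The unit at `x`. -/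
def Arr.unit (x : X) : Arr X := ⟨x, x, 𝟙 x⟩

/-- The inverse map of the groupoid. -/
def Arr.inv (g : Arr X) : Arr X := ⟨g.tgt, g.src, Groupoid.inv g.hom⟩

/-- The product `gh` of a composable pair. -/
def Composable.mul (p : Composable X) : Arr X := ⟨p.x, p.z, p.right ≫ p.left⟩

/-- Composable pairs carry the σ-algebra induced from the product of two copies of the space of
morphisms. -/
instance Composable.instMeasurableSpace [MeasurableSpace (Arr X)] :
    MeasurableSpace (Composable X) :=
  MeasurableSpace.comap
    (fun p => ((⟨p.y, p.z, p.left⟩, ⟨p.x, p.y, p.right⟩) : Arr X × Arr X)) inferInstance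

/-- A Borel groupoid: all structure maps are Borel. -/
class BorelGroupoid (X : Type u) [Groupoid.{v} X] [MeasurableSpace X] [MeasurableSpace (Arr X)] :
    Prop where
  measurable_src : Measurable (Arr.src : Arr X → X)
  measurable_tgt : Measurable (Arr.tgt : Arr X → X)
  measurable_unit : Measurable (Arr.unit : X → Arr X)
  measurable_inv : Measurable (Arr.inv : Arr X → Arr X)
  measurable_mul : Measurable (Composable.mul : Composable X → Arr X)

/-- The fibre `𝒢ˣ = t⁻¹(x)` of the target map. -/
structure Fib (x : X) where
  src : X
  hom : src ⟶ x

/-- The inclusion `𝒢ˣ ⊆ 𝒢`. -/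
def Fib.toArr {x : X} (h : Fib x) : Arr X := ⟨h.src, x, h.hom⟩

instance Fib.instMeasurableSpace [MeasurableSpace (Arr X)] (x : X) : MeasurableSpace (Fib x) :=
  MeasurableSpace.comap Fib.toArr inferInstance

/-- Left translation `h ↦ gh` from `𝒢ˣ` to `𝒢ʸ`, where `g` has source `x` and target `y`. -/
def Fib.translate {x y : X} (g : x ⟶ y) (h : Fib x) : Fib y := ⟨h.src, h.hom ≫ g⟩

/-- The `n`-fold fibred product of `𝒢` over the target map: a point `x` together with `n` elements
of `𝒢ˣ`. -/
structure FibPow (X : Type u) [Groupoid.{v} X] (n : ℕ) where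
  base : X
  pt : Fin n → Fib base

/-- The fibred product carries the σ-algebra induced from `X × 𝒢ⁿ`. -/
instance FibPow.instMeasurableSpace [MeasurableSpace X] [MeasurableSpace (Arr X)] (n : ℕ) :
    MeasurableSpace (FibPow X n) :=
  MeasurableSpace.comap
    (fun y => ((y.base, fun i => (y.pt i).toArr) : X × (Fin n → Arr X))) inferInstance

end Groupoids

/-! ### Measured groupoids and amenability -/

section Measured

/-- A measured groupoid. A measure on `𝒢` that is carried by the fibre `𝒢ˣ` is given as a measure on
the type `Fib x`. -/
structure MeasuredGroupoid (X : Type u) [Groupoid.{v} X] [MeasurableSpace X]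
    [MeasurableSpace (Arr X)] [BorelGroupoid X] where
  /-- the probability measure on the unit space -/
  μ : Measure X
  isProbabilityMeasure_μ : IsProbabilityMeasure μ
  /-- the Borel Haar system -/
  haar : ∀ x : X, Measure (Fib x)
  sigmaFinite_haar : ∀ x, SigmaFinite (haar x)
  measurable_haar : ∀ f : Arr X → ℝ≥0∞, Measurable f →
    Measurable fun x => ∫⁻ h, f h.toArr ∂(haar x)
  haar_invariant : ∀ {x y : X} (g : x ⟶ y) (f : Arr X → ℝ≥0∞), Measurable f →
    ∫⁻ h, f (Fib.translate g h).toArr ∂(haar x) = ∫⁻ h, f h.toArr ∂(haar y)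
  /-- the measure class of the composition `ρ ∘ μ` is preserved by the inverse map -/
  quasiInvariant :
    (μ.bind fun x => (haar x).map Fib.toArr).map Arr.inv ≪
        (μ.bind fun x => (haar x).map Fib.toArr) ∧
      (μ.bind fun x => (haar x).map Fib.toArr) ≪
        (μ.bind fun x => (haar x).map Fib.toArr).map Arr.inv
  /-- the disintegration of a probability measure on `𝒢` in the class of `ρ ∘ μ` -/
  ν : ∀ x : X, Measure (Fib x)
  isProbabilityMeasure_ν : ∀ x, IsProbabilityMeasure (ν x)
  measurable_ν : ∀ f : Arr X → ℝ≥0∞, Measurable f →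
    Measurable fun x => ∫⁻ h, f h.toArr ∂(ν x)
  ν_ac_haar : ∀ x, ν x ≪ haar x
  haar_ac_ν : ∀ x, haar x ≪ ν x

variable {X : Type u} [Groupoid.{v} X] [MeasurableSpace X] [MeasurableSpace (Arr X)]
  [BorelGroupoid X]

namespace MeasuredGroupoid

/-- The probability measure `ν = ∫ νˣ dμ(x)` on `𝒢`. -/
noncomputable def total (𝒢 : MeasuredGroupoid X) : Measure (Arr X) :=
  𝒢.μ.bind fun x => (𝒢.ν x).map Fib.toArr

/-- The product measure `νˣ ⊗ ⋯ ⊗ νˣ` on `(𝒢ˣ)ⁿ`. -/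
noncomputable def νPow (𝒢 : MeasuredGroupoid X) (n : ℕ) (x : X) : Measure (Fin n → Fib x) :=
  Measure.pi fun _ => 𝒢.ν x

/-- The fibred product measure `∫ νˣ ⊗ ⋯ ⊗ νˣ dμ(x)` on the `n`-fold fibred product. -/
noncomputable def totalPow (𝒢 : MeasuredGroupoid X) (n : ℕ) : Measure (FibPow X n) :=
  𝒢.μ.bind fun x => (𝒢.νPow n x).map (FibPow.mk x)

/-- The groupoid is `t`-discrete: the fibres of the target map are countable, and the Haar system
consists of the counting measures. -/
def IsTDiscrete (𝒢 : MeasuredGroupoid X) : Prop :=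
  ∀ x : X, Countable (Fib x) ∧ 𝒢.haar x = Measure.count

end MeasuredGroupoid

/-- Bounded Borel functions. -/
structure BddBorel (Y : Type*) [MeasurableSpace Y] where
  toFun : Y → ℝ
  measurable_toFun : Measurable toFun
  bounded : ∃ C : ℝ, ∀ y, ‖toFun y‖ ≤ C

/-- The class in `L^∞(Y, m)` of a bounded Borel function. -/
noncomputable def BddBorel.toLinf {Y : Type*} [MeasurableSpace Y] (φ : BddBorel Y)
    (m : Measure Y) : Lp ℝ ∞ m :=
  MemLp.toLp φ.toFun
    (memLp_top_of_bound φ.measurable_toFun.aestronglyMeasurable φ.bounded.choose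
      (ae_of_all _ φ.bounded.choose_spec))

/-- The constant function `1`. -/
noncomputable def BddBorel.one (Y : Type*) [MeasurableSpace Y] : BddBorel Y :=
  ⟨fun _ => 1, measurable_const, ⟨1, fun _ => by simp⟩⟩

/-- The composition of a bounded Borel function with a Borel map. -/
def BddBorel.comp {Y Z : Type*} [MeasurableSpace Y] [MeasurableSpace Z] (φ : BddBorel Z)
    (p : Y → Z) (hp : Measurable p) : BddBorel Y :=
  ⟨fun y => φ.toFun (p y), φ.measurable_toFun.comp hp,
    φ.bounded.imp fun _ hC y => hC (p y)⟩

theorem Fib.measurable_toArr {X : Type u} [Groupoid.{v} X] [MeasurableSpace (Arr X)] (x : X) :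
    Measurable (Fib.toArr : Fib x → Arr X) :=
  comap_measurable _

theorem Fib.measurable_translate {x y : X} (g : x ⟶ y) :
    Measurable (Fib.translate g : Fib x → Fib y) := by
  refine Measurable.of_comap_le ?_
  rw [Fib.instMeasurableSpace, MeasurableSpace.comap_comp]
  refine Measurable.comap_le ?_
  have hp : Measurable fun h : Fib x => ((⟨x, y, g⟩, h.toArr) : Arr X × Arr X) :=
    measurable_const.prodMk (Fib.measurable_toArr x)
  have h : Measurable fun h : Fib x => (⟨g, h.hom⟩ : Composable X) := by
    refine Measurable.of_comap_le ?_
    rw [Composable.instMeasurableSpace, MeasurableSpace.comap_comp]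
    exact hp.comap_le
  exact BorelGroupoid.measurable_mul.comp h

/-- `𝔪` is an invariant measurable system of means: each `𝔪ˣ` is a mean on `L^∞(𝒢ˣ, νˣ)` (a linear
functional of norm one with value `1` at the constant function `1`), the function `x ↦ 𝔪ˣ(φ)` is
`μ`-measurable for bounded Borel `φ` on `𝒢`, and `g 𝔪^{s(g)} = 𝔪^{t(g)}` for almost every `g`. -/
structure IsInvariantSystemOfMeans (𝒢 : MeasuredGroupoid X)
    (𝔪 : ∀ x : X, StrongDual ℝ (Lp ℝ ∞ (𝒢.ν x))) : Prop where
  norm_eq_one : ∀ x, ‖𝔪 x‖ = 1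
  map_one : ∀ x, 𝔪 x ((BddBorel.one (Fib x)).toLinf (𝒢.ν x)) = 1
  aemeasurable : ∀ φ : BddBorel (Arr X),
    AEMeasurable (fun x => 𝔪 x ((φ.comp Fib.toArr (Fib.measurable_toArr x)).toLinf (𝒢.ν x))) 𝒢.μ
  invariant : ∀ᵐ g : Arr X ∂𝒢.total, ∀ φ : BddBorel (Fib g.tgt),
    𝔪 g.tgt (φ.toLinf (𝒢.ν g.tgt)) =
      𝔪 g.src ((φ.comp (Fib.translate g.hom) (Fib.measurable_translate g.hom)).toLinf
        (𝒢.ν g.src))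

/-- Amenability of a measured groupoid. -/
def MeasuredGroupoid.IsAmenable (𝒢 : MeasuredGroupoid X) : Prop :=
  ∃ 𝔪 : ∀ x : X, StrongDual ℝ (Lp ℝ ∞ (𝒢.ν x)), IsInvariantSystemOfMeans 𝒢 𝔪

end Measured

/-! ### Measurable bundles of Banach spaces -/

section Bundles

/-- A measurable bundle of Banach spaces with fibres `F x` over `(X, μ)`. -/
structure MeasurableBundle (𝕜 : Type*) [RCLike 𝕜] {X : Type u} [MeasurableSpace X]
    (μ : Measure X) (F : X → Type w) [∀ x, NormedAddCommGroup (F x)]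
    [∀ x, NormedSpace 𝕜 (F x)] where
  complete : ∀ x, CompleteSpace (F x)
  /-- the measurable sections -/
  sections : Set (∀ x, F x)
  add_mem : ∀ σ ∈ sections, ∀ τ ∈ sections, (fun x => σ x + τ x) ∈ sections
  smul_mem : ∀ φ : X → 𝕜, AEMeasurable φ μ → ∀ σ ∈ sections, (fun x => φ x • σ x) ∈ sections
  aemeasurable_norm : ∀ σ ∈ sections, AEMeasurable (fun x => ‖σ x‖) μ
  lim_mem : ∀ (σ : ℕ → ∀ x, F x) (τ : ∀ x, F x), (∀ n, σ n ∈ sections) →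
    (∀ᵐ x ∂μ, Tendsto (fun n => σ n x) atTop (𝓝 (τ x))) → τ ∈ sections

/-- A measurable bundle is separable if countably many measurable sections are dense in almost every
fibre. -/
def MeasurableBundle.IsSeparable {𝕜 : Type*} [RCLike 𝕜] {X : Type u} [MeasurableSpace X]
    {μ : Measure X} {F : X → Type w} [∀ x, NormedAddCommGroup (F x)] [∀ x, NormedSpace 𝕜 (F x)]
    (M : MeasurableBundle 𝕜 μ F) : Prop :=
  ∃ σ : ℕ → ∀ x, F x, (∀ n, σ n ∈ M.sections) ∧
    ∀ᵐ x ∂μ, Dense (Set.range fun n => σ n x)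

/-- The measurable structure generated by a family `Q` of vector fields: the smallest family that
contains `Q` and is closed under sums, products with measurable scalar functions, and almost
everywhere limits of sequences. -/
inductive Generated (𝕜 : Type*) [RCLike 𝕜] {Y : Type*} [MeasurableSpace Y] (m : Measure Y)
    {V : Y → Type*} [∀ y, NormedAddCommGroup (V y)] [∀ y, NormedSpace 𝕜 (V y)]
    (Q : Set (∀ y, V y)) : (∀ y, V y) → Prop
  | base (σ : ∀ y, V y) : σ ∈ Q → Generated 𝕜 m Q σ
  | add (σ τ : ∀ y, V y) : Generated 𝕜 m Q σ → Generated 𝕜 m Q τ →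
      Generated 𝕜 m Q (fun y => σ y + τ y)
  | smul (φ : Y → 𝕜) (σ : ∀ y, V y) : AEMeasurable φ m → Generated 𝕜 m Q σ →
      Generated 𝕜 m Q (fun y => φ y • σ y)
  | lim (σ : ℕ → ∀ y, V y) (τ : ∀ y, V y) : (∀ n, Generated 𝕜 m Q (σ n)) →
      (∀ᵐ y ∂m, Tendsto (fun n => σ n y) atTop (𝓝 (τ y))) → Generated 𝕜 m Q τ

/-- `η` is a measurable section of the pullback along `p : Y → X` of a measurable bundle. -/
def MeasurableBundle.IsPullbackSection {𝕜 : Type*} [RCLike 𝕜] {X : Type u} [MeasurableSpace X]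
    {μ : Measure X} {F : X → Type w} [∀ x, NormedAddCommGroup (F x)] [∀ x, NormedSpace 𝕜 (F x)]
    (M : MeasurableBundle 𝕜 μ F) {Y : Type*} [MeasurableSpace Y] (m : Measure Y) (p : Y → X)
    (η : ∀ y, F (p y)) : Prop :=
  Generated 𝕜 m {ξ : ∀ y, F (p y) | ∃ σ ∈ M.sections, ξ = fun y => σ (p y)} η

variable {X : Type u} [Groupoid.{v} X] [MeasurableSpace X] [MeasurableSpace (Arr X)]
  [BorelGroupoid X]

/-- A measurable `𝒢`-bundle of Banach spaces: a measurable bundle with an isometric left action. -/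
structure MeasurableGBundle (𝕜 : Type*) [RCLike 𝕜] (𝒢 : MeasuredGroupoid X) (F : X → Type w)
    [∀ x, NormedAddCommGroup (F x)] [∀ x, NormedSpace 𝕜 (F x)] extends
    MeasurableBundle 𝕜 𝒢.μ F where
  /-- the operator `L(g) : F_{s(g)} → F_{t(g)}` -/
  act : ∀ {x y : X}, (x ⟶ y) → (F x →ₗᵢ[𝕜] F y)
  act_unit : ∀ (x : X) (v : F x), act (𝟙 x) v = v
  act_mul : ∀ {x y z : X} (g : y ⟶ z) (h : x ⟶ y) (v : F x), act (h ≫ g) v = act g (act h v)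
  measurable_act : ∀ σ ∈ sections,
    toMeasurableBundle.IsPullbackSection 𝒢.total (Arr.tgt : Arr X → X)
      fun g => act g.hom (σ g.src)

end Bundles

/-! ### The complex of essentially bounded sections and bounded cohomology

Throughout, `ℱ` is the predual `𝒢`-bundle with fibres `F x`, and the coefficient bundle is its dual
`ℰ` with fibres `E x = (F x)^*`. -/

section Cohomology

variable {𝕜 : Type*} [RCLike 𝕜] {X : Type u} [Groupoid.{v} X] [MeasurableSpace X]
  [MeasurableSpace (Arr X)] [BorelGroupoid X] {𝒢 : MeasuredGroupoid X} {F : X → Type w}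
  [∀ x, NormedAddCommGroup (F x)] [∀ x, NormedSpace 𝕜 (F x)]

/-- The dual action: `⟨L^*(g) θ, v⟩ = ⟨θ, L(g)⁻¹ v⟩`. -/
noncomputable def MeasurableGBundle.dualAct (ℱ : MeasurableGBundle 𝕜 𝒢 F) {x y : X} (g : x ⟶ y)
    (θ : StrongDual 𝕜 (F x)) : StrongDual 𝕜 (F y) :=
  θ.comp (ℱ.act (Groupoid.inv g)).toContinuousLinearMap

/-- A function `Y → V^*` represents an element of `L^∞_{w*}((Y, m), V^*)`. -/
def IsWeakStarLinf (𝕜 : Type*) [RCLike 𝕜] {Y : Type*} [MeasurableSpace Y] (m : Measure Y)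
    {V : Type*} [NormedAddCommGroup V] [NormedSpace 𝕜 V] (f : Y → StrongDual 𝕜 V) : Prop :=
  (∀ v : V, AEMeasurable (fun y => f y v) m) ∧ ∃ C : ℝ, ∀ᵐ y ∂m, ‖f y‖ ≤ C

/-- The measurable sections of the bundle `x ↦ L¹((𝒢ˣ)ⁿ, νˣ ⊗ ⋯ ⊗ νˣ; F x)`. Its measurable structure
is generated by the vector fields `x ↦ η(x, ·)`, where `η` is a measurable section of the pullback of
`ℱ` to the `n`-fold fibred product with `η(x, ·)` integrable for almost every `x`. -/
def IsL1Section (ℱ : MeasurableGBundle 𝕜 𝒢 F) (n : ℕ)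
    (ξ : ∀ x : X, Lp (F x) 1 (𝒢.νPow n x)) : Prop :=
  Generated 𝕜 𝒢.μ
    {ζ : ∀ x : X, Lp (F x) 1 (𝒢.νPow n x) | ∃ η : ∀ y : FibPow X n, F y.base,
      ℱ.IsPullbackSection (𝒢.totalPow n) FibPow.base η ∧
      ∀ᵐ x ∂𝒢.μ, (ζ x : (Fin n → Fib x) → F x) =ᵐ[𝒢.νPow n x] fun γ => η ⟨x, γ⟩} ξ

/-- Families of functions `f x : (𝒢ˣ)ⁿ → E x`; these represent the vector fields of the bundle
`x ↦ L^∞_{w*}((𝒢ˣ)ⁿ, νˣ ⊗ ⋯ ⊗ νˣ; E x)`. -/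
abbrev Field (𝕜 : Type*) [RCLike 𝕜] {X : Type u} [Groupoid.{v} X] (F : X → Type w)
    [∀ x, NormedAddCommGroup (F x)] [∀ x, NormedSpace 𝕜 (F x)] (n : ℕ) :=
  ∀ x : X, (Fin n → Fib x) → StrongDual 𝕜 (F x)

/-- `f` represents an essentially bounded measurable section of the bundle
`x ↦ L^∞_{w*}((𝒢ˣ)ⁿ, νˣ ⊗ ⋯ ⊗ νˣ; E x)`, with the measurable structure dual to that of
`x ↦ L¹((𝒢ˣ)ⁿ, νˣ ⊗ ⋯ ⊗ νˣ; F x)`. -/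
structure IsLinfSection (ℱ : MeasurableGBundle 𝕜 𝒢 F) (n : ℕ) (f : Field 𝕜 F n) : Prop where
  fibre : ∀ x, IsWeakStarLinf 𝕜 (𝒢.νPow n x) (f x)
  measurable : ∀ ξ : ∀ x : X, Lp (F x) 1 (𝒢.νPow n x), IsL1Section ℱ n ξ →
    AEMeasurable (fun x => ∫ γ, f x γ (ξ x γ) ∂(𝒢.νPow n x)) 𝒢.μ
  essBounded : ∃ C : ℝ, ∀ᵐ x ∂𝒢.μ, ∀ᵐ γ ∂(𝒢.νPow n x), ‖f x γ‖ ≤ C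

/-- Almost `𝒢`-invariance: for almost every `g`, the functions `f (t(g))` and
`γ ↦ L^*(g) (f (s(g)) (g⁻¹γ))` agree almost everywhere. -/
def IsInvariant (ℱ : MeasurableGBundle 𝕜 𝒢 F) (n : ℕ) (f : Field 𝕜 F n) : Prop :=
  ∀ᵐ g : Arr X ∂𝒢.total, ∀ᵐ γ ∂(𝒢.νPow n g.tgt),
    f g.tgt γ =
      ℱ.dualAct g.hom (f g.src fun i => Fib.translate (Groupoid.inv g.hom) (γ i))

/-- `f` represents the zero section: `f x = 0` in `L^∞_{w*}` for almost every `x`. -/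
def IsNull (𝒢 : MeasuredGroupoid X) {n : ℕ} (f : Field 𝕜 F n) : Prop :=
  ∀ᵐ x ∂𝒢.μ, ∀ᵐ γ ∂(𝒢.νPow n x), f x γ = 0

/-- The homogeneous coboundary operator
`(df)(g₀, …, gₙ) = ∑ᵢ (-1)ⁱ f(g₀, …, ĝᵢ, …, gₙ)`. -/
def coboundary {𝕜 : Type*} [RCLike 𝕜] {X : Type u} [Groupoid.{v} X] {F : X → Type w}
    [∀ x, NormedAddCommGroup (F x)] [∀ x, NormedSpace 𝕜 (F x)] {n : ℕ} : Field 𝕜 F n →ₗ[𝕜] Field 𝕜 F (n + 1) where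
  toFun f := fun x γ => ∑ i : Fin (n + 1), (-1 : 𝕜) ^ (i : ℕ) • f x fun j => γ (i.succAbove j)
  map_add' f g := by
    funext x γ
    simp [smul_add, Finset.sum_add_distrib]
  map_smul' c f := by
    funext x γ
    simp [Finset.smul_sum, smul_comm c]

theorem IsWeakStarLinf.aestronglyMeasurable_pairing {Y : Type*} [MeasurableSpace Y] {m : Measure Y}
    {V : Type*} [NormedAddCommGroup V] [NormedSpace 𝕜 V] {f : Y → StrongDual 𝕜 V}
    (hf : IsWeakStarLinf 𝕜 m f) {ξ : Y → V} (hξ : AEStronglyMeasurable ξ m) :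
    AEStronglyMeasurable (fun y => f y (ξ y)) m := by
  have hs : ∀ s : SimpleFunc Y V, AEMeasurable (fun y => f y (s y)) m := by
    intro s
    have he : (fun y => f y (s y)) =
        fun y => ∑ v ∈ s.range, (s ⁻¹' {v}).indicator (fun y => f y v) y := by
      funext y
      rw [Finset.sum_eq_single (s y)]
      · simp
      · intro v _ hv
        simp [Set.indicator, hv.symm]
      · intro h
        exact absurd (s.mem_range_self y) h
    rw [he]
    exact Finset.aemeasurable_fun_sum _ fun v _ => (hf.1 v).indicator (s.measurableSet_fiber v)
  obtain ⟨ξ', hξ', he⟩ := hξ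
  have h1 : AEMeasurable (fun y => f y (ξ' y)) m :=
    aemeasurable_of_tendsto_metrizable_ae atTop (fun n => hs (hξ'.approx n))
      (ae_of_all _ fun y => ((f y).continuous.tendsto _).comp (hξ'.tendsto_approx y))
  refine AEMeasurable.aestronglyMeasurable (h1.congr ?_)
  filter_upwards [he] with y hy
  rw [hy]

theorem IsWeakStarLinf.integrable_pairing {Y : Type*} [MeasurableSpace Y] {m : Measure Y}
    {V : Type*} [NormedAddCommGroup V] [NormedSpace 𝕜 V] {f : Y → StrongDual 𝕜 V}
    (hf : IsWeakStarLinf 𝕜 m f) (ξ : Lp V 1 m) : Integrable (fun y => f y (ξ y)) m := by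
  obtain ⟨C, hC⟩ := hf.2
  have hi : Integrable ξ m := L1.integrable_coeFn ξ
  refine (hi.norm.const_mul C).mono' (hf.aestronglyMeasurable_pairing hi.1) ?_
  filter_upwards [hC] with y hy
  exact (f y).le_of_opNorm_le hy _

/-- The bounded `k`-cochains: (representatives of) the almost `𝒢`-invariant essentially bounded
measurable sections of `x ↦ L^∞_{w*}((𝒢ˣ)^{k+1}, νˣ ⊗ ⋯ ⊗ νˣ; E x)`. -/
noncomputable def cochains (ℱ : MeasurableGBundle 𝕜 𝒢 F) (k : ℕ) :
    Submodule 𝕜 (Field 𝕜 F (k + 1)) where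
  carrier := {f | IsLinfSection ℱ (k + 1) f ∧ IsInvariant ℱ (k + 1) f}
  zero_mem' := by
    refine ⟨⟨fun x => ⟨fun v => ?_, 0, ?_⟩, fun ξ _ => ?_, 0, ?_⟩, ?_⟩
    · simp
    · simp
    · simp
    · simp
    · exact ae_of_all _ fun g => ae_of_all _ fun γ => by
        simp [MeasurableGBundle.dualAct]
  add_mem' := by
    rintro f g ⟨hf, hf'⟩ ⟨hg, hg'⟩
    refine ⟨⟨fun x => ⟨fun v => ?_, ?_⟩, fun ξ hξ => ?_, ?_⟩, ?_⟩
    · exact ((hf.fibre x).1 v).add ((hg.fibre x).1 v)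
    · obtain ⟨C, hC⟩ := (hf.fibre x).2
      obtain ⟨D, hD⟩ := (hg.fibre x).2
      refine ⟨C + D, ?_⟩
      filter_upwards [hC, hD] with y h1 h2
      exact (norm_add_le _ _).trans (add_le_add h1 h2)
    · have he : (fun x => ∫ γ, (f + g) x γ (ξ x γ) ∂(𝒢.νPow (k + 1) x)) = fun x =>
          ∫ γ, f x γ (ξ x γ) ∂(𝒢.νPow (k + 1) x) + ∫ γ, g x γ (ξ x γ) ∂(𝒢.νPow (k + 1) x) := by
        funext x
        exact integral_add ((hf.fibre x).integrable_pairing (ξ x))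
          ((hg.fibre x).integrable_pairing (ξ x))
      rw [he]
      exact (hf.measurable ξ hξ).add (hg.measurable ξ hξ)
    · obtain ⟨C, hC⟩ := hf.essBounded
      obtain ⟨D, hD⟩ := hg.essBounded
      refine ⟨C + D, ?_⟩
      filter_upwards [hC, hD] with x h1 h2
      filter_upwards [h1, h2] with y h1 h2
      exact (norm_add_le _ _).trans (add_le_add h1 h2)
    · filter_upwards [hf', hg'] with a h1 h2
      filter_upwards [h1, h2] with γ h1 h2
      simp only [Pi.add_apply, h1, h2, MeasurableGBundle.dualAct, ContinuousLinearMap.add_comp]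
  smul_mem' := by
    rintro c f ⟨hf, hf'⟩
    refine ⟨⟨fun x => ⟨fun v => ?_, ?_⟩, fun ξ hξ => ?_, ?_⟩, ?_⟩
    · exact ((hf.fibre x).1 v).const_mul c
    · obtain ⟨C, hC⟩ := (hf.fibre x).2
      refine ⟨‖c‖ * C, ?_⟩
      filter_upwards [hC] with y h1
      exact (norm_smul_le c (f x y)).trans (mul_le_mul_of_nonneg_left h1 (norm_nonneg c))
    · have he : (fun x => ∫ γ, (c • f) x γ (ξ x γ) ∂(𝒢.νPow (k + 1) x)) = fun x =>
          c * ∫ γ, f x γ (ξ x γ) ∂(𝒢.νPow (k + 1) x) := by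
        funext x
        exact integral_const_mul c fun γ => f x γ (ξ x γ)
      rw [he]
      exact (hf.measurable ξ hξ).const_mul c
    · obtain ⟨C, hC⟩ := hf.essBounded
      refine ⟨‖c‖ * C, ?_⟩
      filter_upwards [hC] with x h1
      filter_upwards [h1] with y h1
      exact (norm_smul_le c (f x y)).trans (mul_le_mul_of_nonneg_left h1 (norm_nonneg c))
    · filter_upwards [hf'] with a h1
      filter_upwards [h1] with γ h1
      simp only [Pi.smul_apply, h1, MeasurableGBundle.dualAct, ContinuousLinearMap.smul_comp]

/-- The representatives of the zero section. -/
def nullFields (𝕜 : Type*) [RCLike 𝕜] (𝒢 : MeasuredGroupoid X) (F : X → Type w)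
    [∀ x, NormedAddCommGroup (F x)] [∀ x, NormedSpace 𝕜 (F x)] (n : ℕ) :
    Submodule 𝕜 (Field 𝕜 F n) where
  carrier := {f | IsNull 𝒢 f}
  zero_mem' := ae_of_all _ fun _ => ae_of_all _ fun _ => rfl
  add_mem' := by
    intro f g hf hg
    change IsNull 𝒢 (f + g)
    have hf' : IsNull 𝒢 f := hf
    have hg' : IsNull 𝒢 g := hg
    unfold IsNull at *
    filter_upwards [hf', hg'] with x h1 h2
    filter_upwards [h1, h2] with y h1 h2
    simp [h1, h2]
  smul_mem' := by
    intro c f hf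
    change IsNull 𝒢 (c • f)
    have hf' : IsNull 𝒢 f := hf
    unfold IsNull at *
    filter_upwards [hf'] with x h1
    filter_upwards [h1] with y h1
    change c • f x y = 0
    rw [h1]
    ext v
    exact mul_zero c

/-- The bounded `k`-cocycles: bounded cochains `f` with `df = 0` almost everywhere. -/
noncomputable def cocycles (ℱ : MeasurableGBundle 𝕜 𝒢 F) (k : ℕ) :
    Submodule 𝕜 (Field 𝕜 F (k + 1)) :=
  cochains ℱ k ⊓ (nullFields 𝕜 𝒢 F (k + 2)).comap coboundary

/-- The bounded `k`-coboundaries: bounded cochains that agree almost everywhere with `dh` for a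
bounded `(k - 1)`-cochain `h` (with `0` if `k = 0`). -/
noncomputable def coboundaries (ℱ : MeasurableGBundle 𝕜 𝒢 F) : (k : ℕ) →
    Submodule 𝕜 (Field 𝕜 F (k + 1))
  | 0 => cochains ℱ 0 ⊓ nullFields 𝕜 𝒢 F 1
  | k + 1 => cochains ℱ (k + 1) ⊓ ((cochains ℱ k).map coboundary ⊔ nullFields 𝕜 𝒢 F (k + 2))

theorem coboundary_coboundary {𝕜 : Type*} [RCLike 𝕜] {X : Type u} [Groupoid.{v} X]
    {F : X → Type w} [∀ x, NormedAddCommGroup (F x)] [∀ x, NormedSpace 𝕜 (F x)]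
    {n : ℕ} (f : Field 𝕜 F n) : coboundary (coboundary f) = 0 := by
  funext x γ
  change ∑ i : Fin (n + 2), (-1 : 𝕜) ^ (i : ℕ) • ∑ j : Fin (n + 1), (-1 : 𝕜) ^ (j : ℕ) •
    f x (fun l => γ (i.succAbove (j.succAbove l))) = 0
  simp only [Finset.smul_sum, smul_smul, ← pow_add]
  rw [← Finset.sum_product']
  refine Finset.sum_involution (fun p _ => (p.1.succAbove p.2, p.2.predAbove p.1)) ?_ ?_ ?_ ?_
  · rintro ⟨i, j⟩ -
    simp only [← Fin.succAbove_succAbove_succAbove_predAbove i j]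
    rw [Fin.neg_one_pow_succAbove_add_predAbove]
    ext v
    change _ * _ + _ * _ = (0 : 𝕜)
    ring
  · rintro ⟨i, j⟩ - _ h
    exact Fin.succAbove_ne i j (congrArg Prod.fst h)
  · simp
  · rintro ⟨i, j⟩ -
    have h := Fin.succAbove_succAbove_predAbove i j
    refine Prod.ext h (Fin.succAbove_right_injective (p := i) ?_)
    have h' := Fin.succAbove_succAbove_predAbove (i.succAbove j) (j.predAbove i)
    simp only [h] at h' ⊢
    exact h'

theorem coboundary_mem_nullFields {n : ℕ} {f : Field 𝕜 F n} (hf : f ∈ nullFields 𝕜 𝒢 F n) :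
    coboundary f ∈ nullFields 𝕜 𝒢 F (n + 1) := by
  change ∀ᵐ x ∂𝒢.μ, ∀ᵐ γ ∂(𝒢.νPow (n + 1) x), coboundary f x γ = 0
  have hf' : ∀ᵐ x ∂𝒢.μ, ∀ᵐ γ ∂(𝒢.νPow n x), f x γ = 0 := hf
  filter_upwards [hf'] with x hx
  have hp : ∀ i : Fin (n + 1), ∀ᵐ γ ∂(𝒢.νPow (n + 1) x),
      f x (fun j => γ (i.succAbove j)) = 0 := by
    intro i
    have := 𝒢.isProbabilityMeasure_ν
    have h1 := (measurePreserving_piFinSuccAbove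
      (fun _ : Fin (n + 1) => 𝒢.ν x) i).quasiMeasurePreserving
    exact (Measure.quasiMeasurePreserving_snd.comp h1).ae hx
  filter_upwards [ae_all_iff.2 hp] with γ hγ
  change ∑ i : Fin (n + 1), (-1 : 𝕜) ^ (i : ℕ) • f x (fun j => γ (i.succAbove j)) = 0
  refine Finset.sum_eq_zero fun i _ => ?_
  rw [hγ i]
  ext v
  exact mul_zero _

theorem coboundaries_le_cocycles (ℱ : MeasurableGBundle 𝕜 𝒢 F) (k : ℕ) :
    coboundaries ℱ k ≤ cocycles ℱ k := by
  cases k with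
  | zero => exact fun f hf => ⟨hf.1, coboundary_mem_nullFields hf.2⟩
  | succ k =>
    rintro f ⟨hf, hf'⟩
    refine ⟨hf, ?_⟩
    obtain ⟨_, ⟨h, _, rfl⟩, z, hz, rfl⟩ := Submodule.mem_sup.1 hf'
    change coboundary (coboundary h + z) ∈ nullFields 𝕜 𝒢 F (k + 3)
    rw [map_add, coboundary_coboundary, zero_add]
    exact coboundary_mem_nullFields hz

/-- The bounded cohomology `H^k_mb(𝒢, ℰ)` with coefficients in the dual `ℰ` of `ℱ`: cocycles modulo
coboundaries, formed inside the quotient of the space of all fields by the coboundaries. -/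
noncomputable abbrev BoundedCohomology (ℱ : MeasurableGBundle 𝕜 𝒢 F) (k : ℕ) :
    Submodule 𝕜 (Field 𝕜 F (k + 1) ⧸ coboundaries ℱ k) :=
  (cocycles ℱ k).map (coboundaries ℱ k).mkQ

end Cohomology

end BddGroupoid

/-!
The bounded cochain complex is contracted by averaging over the first variable. If `𝔪` is an
invariant measurable system of means, put `⟨(hf)(x)(γ), v⟩ = 𝔪ˣ(g ↦ ⟨f(x)(g, γ), v⟩)`, where `𝔪ˣ` is
extended `𝕜`-linearly to `𝕜`-valued functions (`meanHomotopy`). For a cocycle `f` the cocycle identity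
at `(g, γ)` expresses `f(γ)` as an alternating sum of the values `f(g, γ₀, …, γ̂ᵢ, …)`, and taking the
mean over `g` gives `f = d(hf)` (`sub_coboundary_meanHomotopy_mem_nullFields`). It remains to see that
`hf` is a bounded cochain.

Since the fibres are countable and `νˣ` is equivalent to the counting measure, the only null set of a
power of a fibre is the empty set, so that on the fibres "almost everywhere" means "everywhere".
This makes the values of `hf` at points meaningful, gives the bound `‖hf‖ ≤ ‖f‖`, and lets the
invariance of `f` and of `𝔪` combine to that of `hf` (`IsInvariant.meanHomotopy`).

The point that needs work is the measurability of `hf` (`IsLinfSection.meanHomotopy`). For a section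
`ξ` of the `L¹`-bundle, `∫ ⟨hf(x)(γ), ξ(x)(γ)⟩ dγ` is the mean of the function
`φₓ(g) = ∫ ⟨f(x)(g, γ), ξ(x)(γ)⟩ dγ`, since the sum over `γ` converges absolutely in `L^∞`
(`exists_Linf_eq_integral`). The measurability of `f`, tested against the sections `1_A(g) ξ(x)(γ)`
(`IsL1Section.prependIndicator`), shows that the integrals of `φₓ` over Borel sets `A ⊆ 𝒢` depend
measurably on `x`; as points have positive measure, `φ` is recovered from these integrals as a limit
of averages and so agrees with a Borel function on `𝒢` (`exists_measurable_eq_on_fibres`). The system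
of means is measurable on bounded Borel functions, and a truncation extends this to `φ`
(`IsInvariantSystemOfMeans.aemeasurable_of_measurable`).
-/

namespace BddGroupoid

/-! ### Functionals on `L^∞` and weak-* means -/

section Means

variable {𝕜 : Type*} [RCLike 𝕜] {Y : Type*} [MeasurableSpace Y] {m : Measure Y}
  {V : Type*} [NormedAddCommGroup V] [NormedSpace 𝕜 V]

/-- For a measure whose only null set is the empty set, expressed by `ae m = ⊤`. -/
theorem forall_of_ae {p : Y → Prop} (hm : ae m = ⊤) (h : ∀ᵐ y ∂m, p y) (y : Y) : p y := by
  rw [hm] at h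
  exact eventually_top.1 h y

/-- The `𝕜`-linear extension to `𝕜`-valued functions of a real functional on `L^∞`: over `ℂ`, the
functional `a ↦ φ(re a) + i φ(im a)`. -/
noncomputable def extendMean (𝕜 : Type*) [RCLike 𝕜] (φ : StrongDual ℝ (Lp ℝ ∞ m)) :
    StrongDual 𝕜 (Lp 𝕜 ∞ m) :=
  StrongDual.extendRCLike (φ.comp ((RCLike.reCLM : StrongDual ℝ 𝕜).compLpL ∞ m))

theorem norm_extendMean_le (φ : StrongDual ℝ (Lp ℝ ∞ m)) : ‖extendMean 𝕜 φ‖ ≤ ‖φ‖ := by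
  rw [extendMean, StrongDual.norm_extendRCLike]
  refine (ContinuousLinearMap.opNorm_comp_le _ _).trans ?_
  refine mul_le_of_le_one_right (norm_nonneg _) ?_
  exact (ContinuousLinearMap.norm_compLpL_le _).trans RCLike.reCLM_norm.le

theorem extendMean_apply (φ : StrongDual ℝ (Lp ℝ ∞ m)) (q : Lp 𝕜 ∞ m) :
    extendMean 𝕜 φ q = (φ ((RCLike.reCLM : StrongDual ℝ 𝕜).compLpL ∞ m q) : 𝕜) -
      RCLike.I * (φ ((RCLike.reCLM : StrongDual ℝ 𝕜).compLpL ∞ m ((RCLike.I : 𝕜) • q)) : 𝕜) :=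
  rfl

theorem norm_Linf_le [IsFiniteMeasure m] {q : Lp V ∞ m} {C : ℝ} (hC : 0 ≤ C)
    (h : ∀ᵐ y ∂m, ‖q y‖ ≤ C) : ‖q‖ ≤ C := by
  simpa using Lp.norm_le_of_ae_bound hC h

theorem ae_norm_le_norm_Linf (q : Lp V ∞ m) : ∀ᵐ y ∂m, ‖q y‖ ≤ ‖q‖ := by
  have h := ae_le_eLpNormEssSup (f := q) (μ := m)
  have hq : eLpNorm q ∞ m ≠ ∞ := Lp.eLpNorm_ne_top q
  filter_upwards [h] with y hy
  rw [Lp.norm_def, ← toReal_enorm]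
  exact ENNReal.toReal_mono hq (by rwa [eLpNorm_exponent_top])

theorem IsWeakStarLinf.memLp {f : Y → StrongDual 𝕜 V} (hf : IsWeakStarLinf 𝕜 m f) (v : V) :
    MemLp (fun y => f y v) ∞ m := by
  obtain ⟨C, hC⟩ := hf.2
  refine memLp_top_of_bound (hf.1 v).aestronglyMeasurable (C * ‖v‖) ?_
  filter_upwards [hC] with y hy
  exact (f y).le_of_opNorm_le hy v

theorem IsWeakStarLinf.norm_toLp_le [IsFiniteMeasure m] {f : Y → StrongDual 𝕜 V}
    (hf : IsWeakStarLinf 𝕜 m f) {C : ℝ} (hC : 0 ≤ C) (h : ∀ᵐ y ∂m, ‖f y‖ ≤ C) (v : V) :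
    ‖(hf.memLp v).toLp‖ ≤ C * ‖v‖ := by
  refine norm_Linf_le (by positivity) ?_
  filter_upwards [h, (hf.memLp v).coeFn_toLp] with y hy hy'
  rw [hy']
  exact (f y).le_of_opNorm_le hy v

/-- The operator `V → L^∞`, `v ↦ ⟨f(·), v⟩`, of a weak-* essentially bounded function `f`. -/
noncomputable def IsWeakStarLinf.pairing [IsFiniteMeasure m] {f : Y → StrongDual 𝕜 V}
    (hf : IsWeakStarLinf 𝕜 m f) : V →L[𝕜] Lp 𝕜 ∞ m :=
  LinearMap.mkContinuousOfExistsBound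
    { toFun v := (hf.memLp v).toLp
      map_add' v w := by
        rw [← MemLp.toLp_add]
        exact MemLp.toLp_congr _ _ (ae_of_all _ fun y => map_add (f y) v w)
      map_smul' c v := by
        rw [RingHom.id_apply, ← MemLp.toLp_const_smul]
        exact MemLp.toLp_congr _ _ (ae_of_all _ fun y => map_smul (f y) c v) }
    (by
      obtain ⟨C, hC⟩ := hf.2
      refine ⟨max C 0, fun v => hf.norm_toLp_le (le_max_right _ _) ?_ v⟩
      filter_upwards [hC] with y hy using hy.trans (le_max_left _ _))

open Classical in
/-- The weak-* integral of a function `f : Y → V^*` against a functional `M` on `L^∞`, with the value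
`0` if `f` is not weak-* measurable and essentially bounded. -/
noncomputable def weakStarMean [IsFiniteMeasure m] (M : StrongDual 𝕜 (Lp 𝕜 ∞ m))
    (f : Y → StrongDual 𝕜 V) : StrongDual 𝕜 V :=
  if hf : IsWeakStarLinf 𝕜 m f then M.comp hf.pairing else 0

theorem weakStarMean_apply [IsFiniteMeasure m] (M : StrongDual 𝕜 (Lp 𝕜 ∞ m))
    {f : Y → StrongDual 𝕜 V} (hf : IsWeakStarLinf 𝕜 m f) (v : V) :
    weakStarMean M f v = M (hf.memLp v).toLp := by
  rw [weakStarMean, dif_pos hf]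
  rfl

theorem norm_weakStarMean_le [IsFiniteMeasure m] (M : StrongDual 𝕜 (Lp 𝕜 ∞ m))
    {f : Y → StrongDual 𝕜 V} {C : ℝ} (hC : 0 ≤ C) (h : ∀ᵐ y ∂m, ‖f y‖ ≤ C) :
    ‖weakStarMean M f‖ ≤ ‖M‖ * C := by
  by_cases hf : IsWeakStarLinf 𝕜 m f
  · refine ContinuousLinearMap.opNorm_le_bound _ (by positivity) fun v => ?_
    rw [weakStarMean_apply M hf, mul_assoc]
    exact M.le_opNorm_of_le (hf.norm_toLp_le hC h v)
  · rw [weakStarMean, dif_neg hf, norm_zero]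
    positivity

/-- Evaluation at a point, as a functional on the space `L^∞` of a measure without nonempty null
sets. -/
noncomputable def evalLinf (𝕜 : Type*) [RCLike 𝕜] (hm : ae m = ⊤) (y : Y) :
    StrongDual 𝕜 (Lp 𝕜 ∞ m) :=
  LinearMap.mkContinuous
    { toFun q := q y
      map_add' p q := forall_of_ae hm (Lp.coeFn_add p q) y
      map_smul' c q := forall_of_ae hm (Lp.coeFn_smul c q) y } 1
    fun q => by
      rw [one_mul]
      exact forall_of_ae hm (ae_norm_le_norm_Linf q) y

theorem isWeakStarLinf_of_forall [DiscreteMeasurableSpace Y] {f : Y → StrongDual 𝕜 V} {C : ℝ}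
    (h : ∀ y, ‖f y‖ ≤ C) : IsWeakStarLinf 𝕜 m f :=
  ⟨fun _ => Measurable.of_discrete.aemeasurable, C, ae_of_all _ h⟩

/-- A weak-* mean commutes with an absolutely convergent sum, here written as an integral over a
countable discrete space. -/
theorem exists_Linf_eq_integral [Countable Y] [MeasurableSingletonClass Y] [IsFiniteMeasure m]
    (hm : ae m = ⊤) (M : StrongDual 𝕜 (Lp 𝕜 ∞ m)) {Z : Type*} [MeasurableSpace Z] [Countable Z]
    [MeasurableSingletonClass Z] {p : Measure Z} {f : Y → Z → StrongDual 𝕜 V} {C : ℝ}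
    (hf : ∀ y z, ‖f y z‖ ≤ C) (ξ : Lp V 1 p) :
    ∃ q : Lp 𝕜 ∞ m, (∀ y, q y = ∫ z, f y z (ξ z) ∂p) ∧
      M q = ∫ z, weakStarMean M (fun y => f y z) (ξ z) ∂p := by
  have hw : ∀ z, IsWeakStarLinf 𝕜 m fun y => f y z := fun z => isWeakStarLinf_of_forall (hf · z)
  let Φ : Z → Lp 𝕜 ∞ m := fun z => ((hw z).memLp (ξ z)).toLp
  have hΦ : ∀ y z, Φ z y = f y z (ξ z) := fun y z =>
    forall_of_ae hm ((hw z).memLp (ξ z)).coeFn_toLp y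
  have hi : Integrable Φ p := by
    refine ((L1.integrable_coeFn ξ).norm.const_mul (max C 0)).mono'
      (StronglyMeasurable.of_discrete).aestronglyMeasurable (ae_of_all _ fun z => ?_)
    exact (hw z).norm_toLp_le (le_max_right _ _)
      (ae_of_all _ fun y => (hf y z).trans (le_max_left _ _)) _
  refine ⟨∫ z, Φ z ∂p, fun y => ?_, ?_⟩
  · refine ((evalLinf 𝕜 hm y).integral_comp_comm hi).symm.trans ?_
    exact integral_congr_ae (ae_of_all _ fun z => hΦ y z)
  · rw [← M.integral_comp_comm hi]
    exact integral_congr_ae (ae_of_all _ fun z => (weakStarMean_apply M (hw z) (ξ z)).symm)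

end Means

/-! ### Null sets of the fibres, and the measures on `𝒢` and its fibred powers -/

section Fibres

theorem Fib.toArr_injective {X : Type u} [Groupoid.{v} X] (x : X) :
    Function.Injective (Fib.toArr : Fib x → Arr X) := by
  rintro ⟨y, g⟩ ⟨z, h⟩ e
  simp only [toArr, Arr.mk.injEq] at e
  obtain ⟨rfl, -, e⟩ := e
  cases e
  rfl

variable {X : Type u} [Groupoid.{v} X] [MeasurableSpace (Arr X)]

instance Fib.instMeasurableSingletonClass [MeasurableSingletonClass (Arr X)] (x : X) :
    MeasurableSingletonClass (Fib x) where
  measurableSet_singleton h :=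
    ⟨{h.toArr}, measurableSet_singleton _, by
      ext h'; simp [(Fib.toArr_injective x).eq_iff]⟩

variable [MeasurableSpace X]

/-- The projection of the fibred power that forgets the first of the elements. -/
def FibPow.tail {n : ℕ} (y : FibPow X (n + 1)) : FibPow X n := ⟨y.base, Fin.tail y.pt⟩

theorem FibPow.measurable_tail {n : ℕ} :
    Measurable (FibPow.tail : FibPow X (n + 1) → FibPow X n) := by
  refine Measurable.of_comap_le ?_
  rw [FibPow.instMeasurableSpace, MeasurableSpace.comap_comp]
  have h : Measurable fun y : FibPow X (n + 1) =>
      ((y.base, fun i => (y.pt i).toArr) : X × (Fin (n + 1) → Arr X)) := comap_measurable _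
  refine Measurable.comap_le (h.fst.prodMk (measurable_pi_lambda _ fun i => ?_))
  exact (measurable_pi_apply i.succ).comp h.snd

theorem FibPow.measurable_head {n : ℕ} :
    Measurable fun y : FibPow X (n + 1) => (y.pt 0).toArr := by
  have h : Measurable fun y : FibPow X (n + 1) =>
      ((y.base, fun i => (y.pt i).toArr) : X × (Fin (n + 1) → Arr X)) := comap_measurable _
  exact (measurable_pi_apply 0).comp h.snd

theorem FibPow.measurable_mk (n : ℕ) (x : X) : Measurable (FibPow.mk x : (Fin n → Fib x) → _) := by
  refine Measurable.of_comap_le ?_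
  rw [FibPow.instMeasurableSpace, MeasurableSpace.comap_comp]
  refine Measurable.comap_le (measurable_const.prodMk (measurable_pi_lambda _ fun i => ?_))
  exact (Fib.measurable_toArr x).comp (measurable_pi_apply i)

variable [BorelGroupoid X] (𝒢 : MeasuredGroupoid X)

instance (x : X) : IsProbabilityMeasure (𝒢.ν x) := 𝒢.isProbabilityMeasure_ν x

instance : IsProbabilityMeasure 𝒢.μ := 𝒢.isProbabilityMeasure_μ

instance (n : ℕ) (x : X) : IsProbabilityMeasure (𝒢.νPow n x) := by
  unfold MeasuredGroupoid.νPow; infer_instance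

variable {𝒢}

/-- In a `t`-discrete groupoid the only null set of a fibre is the empty set. -/
theorem MeasuredGroupoid.IsTDiscrete.ae_ν (h : 𝒢.IsTDiscrete) (x : X) : ae (𝒢.ν x) = ⊤ := by
  refine ae_eq_top.2 fun y hy => ?_
  have := 𝒢.haar_ac_ν x hy
  rw [(h x).2] at this
  simp [Measure.count_eq_zero_iff] at this

theorem MeasuredGroupoid.IsTDiscrete.ae_νPow (h : 𝒢.IsTDiscrete) (n : ℕ) (x : X) :
    ae (𝒢.νPow n x) = ⊤ := by
  refine ae_eq_top.2 fun γ => ?_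
  rw [νPow, Measure.pi_singleton]
  exact Finset.prod_ne_zero_iff.2 fun i _ => ae_eq_top.1 (h.ae_ν x) (γ i)

theorem MeasuredGroupoid.measurable_map_ν (𝒢 : MeasuredGroupoid X) :
    Measurable fun x => (𝒢.ν x).map Fib.toArr := by
  refine Measure.measurable_of_measurable_coe _ fun s hs => ?_
  have h := 𝒢.measurable_ν (s.indicator 1) (measurable_one.indicator hs)
  refine (congrArg Measurable (funext fun x => ?_)).mp h
  rw [Measure.map_apply (Fib.measurable_toArr x) hs, ← lintegral_indicator_one
    (Fib.measurable_toArr x hs)]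
  rfl

theorem MeasuredGroupoid.ae_total {𝒢 : MeasuredGroupoid X} {p : Arr X → Prop}
    (h : ∀ᵐ g ∂𝒢.total, p g) : ∀ᵐ x ∂𝒢.μ, ∀ᵐ h : Fib x ∂𝒢.ν x, p h.toArr := by
  filter_upwards [Measure.ae_ae_of_ae_bind 𝒢.measurable_map_ν.aemeasurable h] with x hx
  exact ae_of_ae_map (Fib.measurable_toArr x).aemeasurable hx

theorem MeasuredGroupoid.quasiMeasurePreserving_tgt (𝒢 : MeasuredGroupoid X) :
    Measure.QuasiMeasurePreserving (Arr.tgt : Arr X → X) 𝒢.total 𝒢.μ := by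
  refine ⟨BorelGroupoid.measurable_tgt, Measure.AbsolutelyContinuous.mk fun s hs h0 => ?_⟩
  rw [Measure.map_apply BorelGroupoid.measurable_tgt hs, total, Measure.bind_apply
    (BorelGroupoid.measurable_tgt hs) 𝒢.measurable_map_ν.aemeasurable]
  refine (lintegral_congr_ae ?_).trans lintegral_zero
  filter_upwards [measure_eq_zero_iff_ae_notMem.1 h0] with x hx
  rw [Measure.map_apply (Fib.measurable_toArr x) (BorelGroupoid.measurable_tgt hs)]
  refine measure_mono_null (t := ∅) (fun h hh => ?_) measure_empty
  exact hx hh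

theorem MeasuredGroupoid.measurable_map_νPow (𝒢 : MeasuredGroupoid X) (n : ℕ) :
    Measurable fun x => (𝒢.νPow n x).map (FibPow.mk x) := by
  have hprob : ∀ x, IsProbabilityMeasure ((𝒢.ν x).map Fib.toArr) := fun x =>
    Measure.isProbabilityMeasure_map (Fib.measurable_toArr x).aemeasurable
  -- The powers of the pushforwards of `νˣ` to `𝒢` form a kernel, by a π-system argument on boxes.
  have hpi : Measurable fun x => Measure.pi fun _ : Fin n => (𝒢.ν x).map Fib.toArr := by
    refine Measurable.measure_of_isPiSystem_of_isProbabilityMeasure generateFrom_pi.symm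
      isPiSystem_pi ?_
    rintro _ ⟨s, hs, rfl⟩
    simp only [Measure.pi_pi]
    exact Finset.measurable_prod _ fun i _ =>
      (Measure.measurable_coe (hs i (Set.mem_univ i))).comp 𝒢.measurable_map_ν
  let κ : ProbabilityTheory.Kernel X (Fin n → Arr X) := ⟨_, hpi⟩
  have : ProbabilityTheory.IsMarkovKernel κ := ⟨fun x => by
    change IsProbabilityMeasure (Measure.pi _); infer_instance⟩
  refine Measure.measurable_of_measurable_coe _ ?_
  rintro _ ⟨t, ht, rfl⟩
  refine (congrArg Measurable (funext fun x => ?_)).mp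
    (ProbabilityTheory.Kernel.measurable_kernel_prodMk_left (κ := κ) ht)
  change Measure.pi (fun _ : Fin n => (𝒢.ν x).map Fib.toArr) _ = _
  rw [Measure.map_apply (FibPow.measurable_mk n x) ⟨t, ht, rfl⟩,
    ← Measure.pi_map_pi fun _ => (Fib.measurable_toArr x).aemeasurable,
    Measure.map_apply (by
      exact measurable_pi_lambda _ fun i => (Fib.measurable_toArr x).comp (measurable_pi_apply i))
      (measurable_prodMk_left ht)]
  rfl

theorem MeasuredGroupoid.measurePreserving_tail (𝒢 : MeasuredGroupoid X) (n : ℕ) (x : X) :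
    MeasurePreserving (Fin.tail : (Fin (n + 1) → Fib x) → Fin n → Fib x) (𝒢.νPow (n + 1) x)
      (𝒢.νPow n x) :=
  measurePreserving_snd.comp (measurePreserving_piFinSuccAbove (fun _ : Fin (n + 1) => 𝒢.ν x) 0)

theorem MeasuredGroupoid.quasiMeasurePreserving_tail (𝒢 : MeasuredGroupoid X) (n : ℕ) :
    Measure.QuasiMeasurePreserving (FibPow.tail : FibPow X (n + 1) → FibPow X n)
      (𝒢.totalPow (n + 1)) (𝒢.totalPow n) := by
  refine ⟨FibPow.measurable_tail, Measure.AbsolutelyContinuous.mk fun s hs h0 => ?_⟩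
  rw [totalPow, Measure.bind_apply hs (𝒢.measurable_map_νPow n).aemeasurable] at h0
  rw [Measure.map_apply FibPow.measurable_tail hs, totalPow, Measure.bind_apply
    (FibPow.measurable_tail hs) (𝒢.measurable_map_νPow _).aemeasurable, ← h0]
  refine lintegral_congr fun x => ?_
  rw [Measure.map_apply (FibPow.measurable_mk _ x) hs,
    Measure.map_apply (FibPow.measurable_mk _ x) (FibPow.measurable_tail hs),
    ← (𝒢.measurePreserving_tail n x).measure_preimage
      (FibPow.measurable_mk _ x hs).nullMeasurableSet]
  rfl

end Fibres

/-! ### Pullbacks of sections and of `L¹`-functions -/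

section Pullback

variable {𝕜 : Type*} [RCLike 𝕜]

theorem memLp_indicator_comp {Y Z : Type*} [MeasurableSpace Y] [MeasurableSpace Z] {m : Measure Y}
    {p : Measure Z} {V : Type*} [NormedAddCommGroup V] {r : Z → Y} (hr : MeasurePreserving r p m)
    {S : Set Z} (hS : MeasurableSet S) (u : Lp V 1 m) : MemLp (S.indicator (u ∘ r)) 1 p :=
  ((Lp.memLp u).comp_measurePreserving hr).indicator hS

/-- The operator `u ↦ 1_S · (u ∘ r)` on `L¹`, for a measure preserving map `r` and a measurable
set `S`. -/
noncomputable def indicatorPullback (𝕜 : Type*) [RCLike 𝕜] {Y Z : Type*} [MeasurableSpace Y]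
    [MeasurableSpace Z] {m : Measure Y} {p : Measure Z} {V : Type*} [NormedAddCommGroup V]
    [NormedSpace 𝕜 V] {r : Z → Y} (hr : MeasurePreserving r p m) {S : Set Z}
    (hS : MeasurableSet S) : Lp V 1 m →L[𝕜] Lp V 1 p :=
  LinearMap.mkContinuous
    { toFun u := (memLp_indicator_comp hr hS u).toLp
      map_add' u v := by
        rw [← MemLp.toLp_add]
        refine MemLp.toLp_congr _ _ ?_
        filter_upwards [hr.quasiMeasurePreserving.ae (Lp.coeFn_add u v)] with z hz
        by_cases h : z ∈ S
        · simpa only [Set.indicator_of_mem h, Pi.add_apply, Function.comp_apply] using hz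
        · simp [h]
      map_smul' c u := by
        rw [RingHom.id_apply, ← MemLp.toLp_const_smul]
        refine MemLp.toLp_congr _ _ ?_
        filter_upwards [hr.quasiMeasurePreserving.ae (Lp.coeFn_smul c u)] with z hz
        by_cases h : z ∈ S
        · simpa only [Set.indicator_of_mem h, Pi.smul_apply, Function.comp_apply] using hz
        · simp [h] } 1
    fun u => by
      rw [one_mul]
      change ‖(memLp_indicator_comp hr hS u).toLp‖ ≤ _
      rw [Lp.norm_toLp, Lp.norm_def]
      refine ENNReal.toReal_mono (Lp.eLpNorm_ne_top u) ((eLpNorm_indicator_le _).trans ?_)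
      rw [eLpNorm_comp_measurePreserving (Lp.memLp u).1 hr]

theorem coeFn_indicatorPullback {Y Z : Type*} [MeasurableSpace Y]
    [MeasurableSpace Z] {m : Measure Y} {p : Measure Z} {V : Type*} [NormedAddCommGroup V]
    [NormedSpace 𝕜 V] {r : Z → Y} (hr : MeasurePreserving r p m) {S : Set Z}
    (hS : MeasurableSet S) (u : Lp V 1 m) :
    indicatorPullback 𝕜 hr hS u =ᵐ[p] S.indicator (u ∘ r) :=
  MemLp.coeFn_toLp (memLp_indicator_comp hr hS u)

/-- Sections of a pulled back bundle can be pulled back further along a map that respects null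
sets. -/
theorem MeasurableBundle.IsPullbackSection.comp {X : Type u} [MeasurableSpace X]
    {μ : Measure X} {F : X → Type w} [∀ x, NormedAddCommGroup (F x)] [∀ x, NormedSpace 𝕜 (F x)]
    {M : MeasurableBundle 𝕜 μ F} {Y Z : Type*} [MeasurableSpace Y] [MeasurableSpace Z]
    {m : Measure Y} {p : Measure Z} {q : Y → X} {η : ∀ y, F (q y)}
    (h : M.IsPullbackSection m q η) {r : Z → Y} (hr : Measure.QuasiMeasurePreserving r p m) :
    M.IsPullbackSection p (q ∘ r) fun z => η (r z) := by
  induction h with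
  | base σ hσ =>
    obtain ⟨τ, hτ, rfl⟩ := hσ
    exact .base _ ⟨τ, hτ, rfl⟩
  | add σ τ _ _ h1 h2 => exact .add _ _ h1 h2
  | smul φ σ hφ _ h => exact .smul _ _ (hφ.comp_quasiMeasurePreserving hr) h
  | lim σ τ _ hlim h => exact .lim _ _ h (hr.ae hlim)

theorem measurableSet_head_mem {X : Type u} [Groupoid.{v} X] [MeasurableSpace (Arr X)]
    (x : X) (n : ℕ) {A : Set (Arr X)} (hA : MeasurableSet A) :
    MeasurableSet {γ : Fin (n + 1) → Fib x | (γ 0).toArr ∈ A} :=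
  (Fib.measurable_toArr x).comp (measurable_pi_apply 0) hA

variable {X : Type u} [Groupoid.{v} X] [MeasurableSpace X] [MeasurableSpace (Arr X)]
  [BorelGroupoid X] {𝒢 : MeasuredGroupoid X} {F : X → Type w}
  [∀ x, NormedAddCommGroup (F x)] [∀ x, NormedSpace 𝕜 (F x)]

/-- For a section `ξ` of the `L¹`-bundle over the `n`-th fibred power, the section
`(g, γ) ↦ 1_A(g) ξ(γ)` over the next fibred power. -/
noncomputable def prependIndicator (𝕜 : Type*) [RCLike 𝕜] [∀ x, NormedSpace 𝕜 (F x)]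
    {n : ℕ} {A : Set (Arr X)}
    (hA : MeasurableSet A) (ξ : ∀ x : X, Lp (F x) 1 (𝒢.νPow n x)) (x : X) :
    Lp (F x) 1 (𝒢.νPow (n + 1) x) :=
  indicatorPullback 𝕜 (𝒢.measurePreserving_tail n x) (measurableSet_head_mem x n hA) (ξ x)

theorem IsL1Section.prependIndicator {ℱ : MeasurableGBundle 𝕜 𝒢 F} {n : ℕ}
    {ξ : ∀ x : X, Lp (F x) 1 (𝒢.νPow n x)} (h : IsL1Section ℱ n ξ) {A : Set (Arr X)}
    (hA : MeasurableSet A) : IsL1Section ℱ (n + 1) (prependIndicator 𝕜 hA ξ) := by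
  induction h with
  | base ξ hξ =>
    obtain ⟨η, hη, hξη⟩ := hξ
    refine .base _ ⟨fun y => {z : FibPow X (n + 1) | (z.pt 0).toArr ∈ A}.indicator
      (1 : FibPow X (n + 1) → 𝕜) y • η y.tail, ?_, ?_⟩
    · refine .smul _ _ ?_ (hη.comp (𝒢.quasiMeasurePreserving_tail n))
      exact (measurable_one.indicator (FibPow.measurable_head hA)).aemeasurable
    · filter_upwards [hξη] with x hx
      filter_upwards [coeFn_indicatorPullback (𝕜 := 𝕜) (𝒢.measurePreserving_tail n x)
        (measurableSet_head_mem x n hA) (ξ x),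
        (𝒢.measurePreserving_tail n x).quasiMeasurePreserving.ae hx] with γ h1 h2
      refine h1.trans ?_
      by_cases h : (γ 0).toArr ∈ A
      · simp only [Set.indicator_of_mem (show γ ∈ {γ | (γ 0).toArr ∈ A} from h),
          Set.indicator_of_mem (show FibPow.mk x γ ∈ {z | (z.pt 0).toArr ∈ A} from h)]
        exact h2.trans (one_smul 𝕜 (η ⟨x, Fin.tail γ⟩)).symm
      · simp only [Set.indicator_of_notMem (show γ ∉ {γ | (γ 0).toArr ∈ A} from h),
          Set.indicator_of_notMem (show FibPow.mk x γ ∉ {z | (z.pt 0).toArr ∈ A} from h)]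
        exact (zero_smul 𝕜 (η ⟨x, Fin.tail γ⟩)).symm
  | add σ τ _ _ h1 h2 =>
    have e : BddGroupoid.prependIndicator 𝕜 hA (fun x => σ x + τ x) = fun x =>
        BddGroupoid.prependIndicator 𝕜 hA σ x + BddGroupoid.prependIndicator 𝕜 hA τ x :=
      funext fun x => map_add _ _ _
    rw [e]
    exact .add _ _ h1 h2
  | smul φ σ hφ _ h =>
    have e : BddGroupoid.prependIndicator 𝕜 hA (fun x => φ x • σ x) = fun x =>
        φ x • BddGroupoid.prependIndicator 𝕜 hA σ x :=
      funext fun x => map_smul _ _ _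
    rw [e]
    exact .smul _ _ hφ h
  | lim σ τ _ hlim h =>
    refine Generated.lim _ _ h ?_
    filter_upwards [hlim] with x hx
    exact ((ContinuousLinearMap.continuous _).tendsto _).comp hx

/-- By Fubini, pairing `f` with the section `1_A(g) ξ(γ)` amounts to integrating over `A` the pairing of
the slices `f(g, ·)` with `ξ`. -/
theorem integral_prependIndicator {n : ℕ} {x : X} {f : (Fin (n + 1) → Fib x) → StrongDual 𝕜 (F x)}
    (hf : IsWeakStarLinf 𝕜 (𝒢.νPow (n + 1) x) f) (ξ : ∀ x : X, Lp (F x) 1 (𝒢.νPow n x))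
    {A : Set (Arr X)} (hA : MeasurableSet A) :
    ∫ γ, f γ (prependIndicator 𝕜 hA ξ x γ) ∂(𝒢.νPow (n + 1) x) =
      ∫ g in Fib.toArr ⁻¹' A, (∫ γ, f (Fin.cons g γ) (ξ x γ) ∂(𝒢.νPow n x)) ∂(𝒢.ν x) := by
  let e := MeasurableEquiv.piFinSuccAbove (fun _ : Fin (n + 1) => Fib x) 0
  have he : MeasurePreserving e (𝒢.νPow (n + 1) x) ((𝒢.ν x).prod (𝒢.νPow n x)) :=
    measurePreserving_piFinSuccAbove (fun _ : Fin (n + 1) => 𝒢.ν x) 0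
  let G : Fib x × (Fin n → Fib x) → 𝕜 := fun p =>
    (Fib.toArr ⁻¹' A).indicator (fun g => f (Fin.cons g p.2) (ξ x p.2)) p.1
  have hG : (fun γ => f γ (prependIndicator 𝕜 hA ξ x γ)) =ᵐ[𝒢.νPow (n + 1) x]
      fun γ => G (e γ) := by
    filter_upwards [coeFn_indicatorPullback (𝕜 := 𝕜) (𝒢.measurePreserving_tail n x)
        (measurableSet_head_mem x n hA) (ξ x)] with γ hγ
    have hc : Fin.cons (γ 0) (Fin.tail γ) = γ := Fin.cons_self_tail γ
    change f γ (indicatorPullback 𝕜 _ _ (ξ x) γ) = (Fib.toArr ⁻¹' A).indicator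
      (fun g => f (Fin.cons g (Fin.tail γ)) (ξ x (Fin.tail γ))) (γ 0)
    rw [hγ]
    by_cases h : (γ 0).toArr ∈ A
    · simp [h, hc]
    · simp [h]
  have hi : Integrable G ((𝒢.ν x).prod (𝒢.νPow n x)) := by
    rw [← he.integrable_comp_emb e.measurableEmbedding]
    exact (hf.integrable_pairing (prependIndicator 𝕜 hA ξ x)).congr hG
  rw [integral_congr_ae hG, he.integral_comp' G, integral_prod _ hi,
    ← integral_indicator (Fib.measurable_toArr x hA)]
  refine integral_congr_ae (ae_of_all _ fun g => ?_)
  by_cases h : g.toArr ∈ A <;> simp [G, h]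

end Pullback

/-! ### Measurability and invariance of means -/

section Measurability

variable {𝕜 : Type*} [RCLike 𝕜] {X : Type u} [Groupoid.{v} X] [MeasurableSpace X]
  [MeasurableSpace (Arr X)] [BorelGroupoid X] {𝒢 : MeasuredGroupoid X}

/-- A field of integrable functions on the fibres of a `t`-discrete groupoid whose integrals over
all Borel sets depend measurably on the base point comes from a Borel function on `𝒢`. Its value at
`g` is the limit of its averages over the sets of a sequence of finer and finer finite partitions of
`𝒢` that contain `g`, since these sets shrink to `{g}`, which has positive measure. -/
theorem exists_measurable_eq_on_fibres [StandardBorelSpace (Arr X)] (hd : 𝒢.IsTDiscrete)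
    {φ : ∀ x : X, Fib x → 𝕜} (hi : ∀ᵐ x ∂𝒢.μ, Integrable (φ x) (𝒢.ν x))
    (hφ : ∀ A : Set (Arr X), MeasurableSet A →
      AEMeasurable (fun x => ∫ g in Fib.toArr ⁻¹' A, φ x g ∂(𝒢.ν x)) 𝒢.μ) :
    ∃ Φ : Arr X → 𝕜, Measurable Φ ∧ ∀ᵐ x ∂𝒢.μ, ∀ g : Fib x, Φ g.toArr = φ x g := by
  obtain ⟨b, hb, hinj⟩ :=
    MeasurableSpace.measurable_injection_nat_bool_of_countablySeparated (Arr X)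
  let P (j : ℕ) (w : Fin j → Bool) : Set (Arr X) := {h | ∀ i : Fin j, b h i = w i}
  have hP (j : ℕ) (w : Fin j → Bool) : MeasurableSet (P j w) := by
    have e : P j w = ⋂ i : Fin j, (fun h => b h i) ⁻¹' {w i} := by ext; simp [P]
    rw [e]
    exact MeasurableSet.iInter fun i =>
      ((measurable_pi_apply (i : ℕ)).comp hb) (measurableSet_singleton _)
  let avg (j : ℕ) (w : Fin j → Bool) (x : X) : 𝕜 :=
    (∫ h in Fib.toArr ⁻¹' P j w, φ x h ∂(𝒢.ν x)) / (((𝒢.ν x).real (Fib.toArr ⁻¹' P j w) : ℝ) : 𝕜)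
  have havg (j : ℕ) (w : Fin j → Bool) : AEMeasurable (avg j w) 𝒢.μ := by
    have h : Measurable fun x => (𝒢.ν x).real (Fib.toArr ⁻¹' P j w) := by
      refine (congrArg Measurable (funext fun x => ?_)).mp
        ((Measure.measurable_coe (hP j w)).comp 𝒢.measurable_map_ν).ennreal_toReal
      exact congrArg ENNReal.toReal (Measure.map_apply (Fib.measurable_toArr x) (hP j w))
    exact (hφ _ (hP j w)).div (RCLike.measurable_ofReal.comp h).aemeasurable
  have hlim : AEMeasurable (fun g : Arr X => φ g.tgt ⟨g.src, g.hom⟩) 𝒢.total := by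
    refine aemeasurable_of_tendsto_metrizable_ae atTop
      (f := fun j g => ∑ w : Fin j → Bool, (P j w).indicator (fun g => avg j w g.tgt) g)
      (fun j => Finset.aemeasurable_fun_sum _ fun w _ => AEMeasurable.indicator
        ((havg j w).comp_quasiMeasurePreserving 𝒢.quasiMeasurePreserving_tgt) (hP j w)) ?_
    filter_upwards [𝒢.quasiMeasurePreserving_tgt.ae hi]
    rintro ⟨y, x, g⟩ hx
    change Integrable (φ x) (𝒢.ν x) at hx
    let γ : Fib x := ⟨y, g⟩
    let w (j : ℕ) : Fin j → Bool := fun i => b γ.toArr i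
    let S (j : ℕ) : Set (Fib x) := Fib.toArr ⁻¹' P j (w j)
    have hS (j : ℕ) : MeasurableSet (S j) := Fib.measurable_toArr x (hP j _)
    have hanti : Antitone S := fun i j hij h hh l => hh ⟨l, l.2.trans_le hij⟩
    have hinter : ⋂ j, S j = {γ} := by
      ext h
      simp only [Set.mem_iInter, Set.mem_singleton_iff]
      refine ⟨fun hh => Fib.toArr_injective x (hinj (funext fun i => ?_)), ?_⟩
      · exact hh (i + 1) ⟨i, i.lt_succ_self⟩
      · rintro rfl j i
        rfl
    have hnum : Tendsto (fun j => ∫ h in S j, φ x h ∂(𝒢.ν x)) atTop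
        (𝓝 ((((𝒢.ν x).real {γ} : ℝ) : 𝕜) * φ x γ)) := by
      have h := tendsto_setIntegral_of_antitone hS hanti ⟨0, hx.integrableOn⟩
      rwa [hinter, integral_singleton, RCLike.real_smul_eq_coe_mul] at h
    have hden : Tendsto (fun j => (((𝒢.ν x).real (S j) : ℝ) : 𝕜)) atTop
        (𝓝 (((𝒢.ν x).real {γ} : ℝ) : 𝕜)) := by
      have h := tendsto_measure_iInter_atTop (μ := 𝒢.ν x)
        (fun j => (hS j).nullMeasurableSet) hanti ⟨0, measure_ne_top _ _⟩
      rw [hinter] at h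
      exact ((RCLike.continuous_ofReal (K := 𝕜)).tendsto _).comp
        ((ENNReal.tendsto_toReal (measure_ne_top _ _)).comp h)
    have hpos : (((𝒢.ν x).real {γ} : ℝ) : 𝕜) ≠ 0 := by
      rw [RCLike.ofReal_ne_zero, measureReal_ne_zero_iff]
      exact ae_eq_top.1 (hd.ae_ν x) γ
    have h := hnum.div hden hpos
    rw [mul_div_cancel_left₀ _ hpos] at h
    refine h.congr fun j => ?_
    rw [Finset.sum_eq_single (w j)]
    · have hmem : γ.toArr ∈ P j (w j) := fun i => rfl
      exact (Set.indicator_of_mem hmem fun g : Arr X => avg j (w j) g.tgt).symm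
    · intro w' _ hw'
      have hmem : γ.toArr ∉ P j w' := fun h => hw' (funext fun i => (h i).symm)
      exact Set.indicator_of_notMem hmem fun g : Arr X => avg j w' g.tgt
    · exact fun h => absurd (Finset.mem_univ _) h
  obtain ⟨Φ, hΦ, h⟩ := hlim
  refine ⟨Φ, hΦ, ?_⟩
  filter_upwards [MeasuredGroupoid.ae_total h] with x hx g
  exact (forall_of_ae (hd.ae_ν x) hx g).symm

/-- The truncation of a Borel function to values in `[-N, N]`. -/
noncomputable def BddBorel.clamp {Y : Type*} [MeasurableSpace Y] {ψ : Y → ℝ} (hψ : Measurable ψ)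
    (N : ℕ) : BddBorel Y where
  toFun y := max (-N) (min N (ψ y))
  measurable_toFun := measurable_const.max (measurable_const.min hψ)
  bounded := ⟨N, fun y => abs_le.2
    ⟨le_max_left _ _, max_le (by linarith [N.cast_nonneg (α := ℝ)]) (min_le_left _ _)⟩⟩

theorem BddBorel.coeFn_toLinf {Y : Type*} [MeasurableSpace Y] (φ : BddBorel Y) (m : Measure Y) :
    φ.toLinf m =ᵐ[m] φ.toFun :=
  MemLp.coeFn_toLp _

variable {𝔪 : ∀ x : X, StrongDual ℝ (Lp ℝ ∞ (𝒢.ν x))}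

/-- The measurability of a system of means passes from bounded Borel functions on `𝒢` to Borel
functions that are essentially bounded on each fibre, but not uniformly, by truncation. -/
theorem IsInvariantSystemOfMeans.aemeasurable_of_measurable (h𝔪 : IsInvariantSystemOfMeans 𝒢 𝔪)
    {ψ : Arr X → ℝ} (hψ : Measurable ψ) (q : ∀ x, Lp ℝ ∞ (𝒢.ν x))
    (hq : ∀ᵐ x ∂𝒢.μ, q x =ᵐ[𝒢.ν x] fun g => ψ g.toArr) :
    AEMeasurable (fun x => 𝔪 x (q x)) 𝒢.μ := by
  refine aemeasurable_of_tendsto_metrizable_ae atTop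
    (fun N => h𝔪.aemeasurable (BddBorel.clamp hψ N)) ?_
  filter_upwards [hq] with x hx
  obtain ⟨N₀, hN₀⟩ := exists_nat_ge ‖q x‖
  refine tendsto_const_nhds.congr' ?_
  filter_upwards [eventually_ge_atTop N₀] with N hN
  congr 1
  refine Lp.ext ?_
  filter_upwards [hx, ae_norm_le_norm_Linf (q x), BddBorel.coeFn_toLinf
    ((BddBorel.clamp hψ N).comp Fib.toArr (Fib.measurable_toArr x)) (𝒢.ν x)] with g h1 h2 h3
  have h4 : |ψ g.toArr| ≤ N := by
    rw [← h1]
    exact (h2.trans hN₀).trans (by exact_mod_cast hN)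
  rw [h3, h1]
  change ψ g.toArr = max (-(N : ℝ)) (min (N : ℝ) (ψ g.toArr))
  rw [min_eq_right (abs_le.1 h4).2, max_eq_right (abs_le.1 h4).1]

theorem IsInvariantSystemOfMeans.aemeasurable_extendMean (h𝔪 : IsInvariantSystemOfMeans 𝒢 𝔪)
    {Φ : Arr X → 𝕜} (hΦ : Measurable Φ) (q : ∀ x, Lp 𝕜 ∞ (𝒢.ν x))
    (hq : ∀ᵐ x ∂𝒢.μ, q x =ᵐ[𝒢.ν x] fun g => Φ g.toArr) :
    AEMeasurable (fun x => extendMean 𝕜 (𝔪 x) (q x)) 𝒢.μ := by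
  have key {Ψ : Arr X → 𝕜} (hΨ : Measurable Ψ) (p : ∀ x, Lp 𝕜 ∞ (𝒢.ν x))
      (hp : ∀ᵐ x ∂𝒢.μ, p x =ᵐ[𝒢.ν x] fun g => Ψ g.toArr) : AEMeasurable (fun x =>
        (𝔪 x ((RCLike.reCLM : StrongDual ℝ 𝕜).compLpL ∞ (𝒢.ν x) (p x)) : 𝕜)) 𝒢.μ := by
    refine RCLike.measurable_ofReal.comp_aemeasurable (h𝔪.aemeasurable_of_measurable
      (RCLike.measurable_re.comp hΨ) _ ?_)
    filter_upwards [hp] with x hx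
    filter_upwards [hx, (RCLike.reCLM : StrongDual ℝ 𝕜).coeFn_compLpL (p x)] with g h1 h2
    rw [h2, h1]
    rfl
  simp only [extendMean_apply]
  refine (key hΦ q hq).sub ((key (hΦ.const_mul RCLike.I) _ ?_).const_mul _)
  filter_upwards [hq] with x hx
  filter_upwards [hx, Lp.coeFn_smul (RCLike.I : 𝕜) (q x)] with g h1 h2
  rw [h2, Pi.smul_apply, h1, smul_eq_mul]

/-- The invariance of a system of means, for the `𝕜`-linear extensions of the means. -/
theorem IsInvariantSystemOfMeans.extendMean_translate [MeasurableSingletonClass (Arr X)]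
    (hd : 𝒢.IsTDiscrete) (h𝔪 : IsInvariantSystemOfMeans 𝒢 𝔪) :
    ∀ᵐ g ∂𝒢.total, ∀ (q : Lp 𝕜 ∞ (𝒢.ν g.tgt)) (q' : Lp 𝕜 ∞ (𝒢.ν g.src)),
      (∀ h, q' h = q (Fib.translate g.hom h)) →
        extendMean 𝕜 (𝔪 g.tgt) q = extendMean 𝕜 (𝔪 g.src) q' := by
  filter_upwards [h𝔪.invariant] with g hg
  have hre {x : X} (p : Lp 𝕜 ∞ (𝒢.ν x)) (h : Fib x) :
      (RCLike.reCLM : StrongDual ℝ 𝕜).compLpL ∞ (𝒢.ν x) p h = RCLike.re (p h) :=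
    forall_of_ae (hd.ae_ν x) ((RCLike.reCLM : StrongDual ℝ 𝕜).coeFn_compLpL p) h
  have key (q : Lp 𝕜 ∞ (𝒢.ν g.tgt)) (q' : Lp 𝕜 ∞ (𝒢.ν g.src))
      (hq : ∀ h, q' h = q (Fib.translate g.hom h)) :
      𝔪 g.tgt ((RCLike.reCLM : StrongDual ℝ 𝕜).compLpL ∞ (𝒢.ν g.tgt) q) =
        𝔪 g.src ((RCLike.reCLM : StrongDual ℝ 𝕜).compLpL ∞ (𝒢.ν g.src) q') := by
    have := (hd g.tgt).1
    let φ : BddBorel (Fib g.tgt) :=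
      ⟨fun h => RCLike.re (q h), Measurable.of_discrete, ‖q‖, fun h =>
        (RCLike.norm_re_le_norm _).trans
          (forall_of_ae (hd.ae_ν _) (ae_norm_le_norm_Linf q) h)⟩
    convert hg φ using 2
    · refine Lp.ext ?_
      filter_upwards [φ.coeFn_toLinf (𝒢.ν g.tgt)] with h h1
      rw [h1, hre]
    · refine Lp.ext ?_
      filter_upwards [BddBorel.coeFn_toLinf (φ.comp _ (Fib.measurable_translate g.hom))
        (𝒢.ν g.src)] with h h1
      rw [h1, hre, hq]
      rfl
  intro q q' hq
  rw [extendMean_apply, extendMean_apply, key q q' hq,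
    key ((RCLike.I : 𝕜) • q) ((RCLike.I : 𝕜) • q')]
  intro h
  have h1 := forall_of_ae (hd.ae_ν _) (Lp.coeFn_smul (RCLike.I : 𝕜) q') h
  have h2 := forall_of_ae (hd.ae_ν _) (Lp.coeFn_smul (RCLike.I : 𝕜) q) (Fib.translate g.hom h)
  rw [h1, h2, Pi.smul_apply, Pi.smul_apply, hq]

end Measurability

/-! ### The contracting homotopy -/

section Homotopy

variable {𝕜 : Type*} [RCLike 𝕜] {X : Type u} [Groupoid.{v} X] [MeasurableSpace X]
  [MeasurableSpace (Arr X)] [BorelGroupoid X] {𝒢 : MeasuredGroupoid X} {F : X → Type w}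
  [∀ x, NormedAddCommGroup (F x)] [∀ x, NormedSpace 𝕜 (F x)]
  {𝔪 : ∀ x : X, StrongDual ℝ (Lp ℝ ∞ (𝒢.ν x))}

/-- The contracting homotopy `(hf)(x)(γ) = ∫ f(x)(g, γ) d𝔪ˣ(g)`: the weak-* mean of a field over
the first of its variables. -/
noncomputable def meanHomotopy (𝔪 : ∀ x : X, StrongDual ℝ (Lp ℝ ∞ (𝒢.ν x))) {n : ℕ}
    (f : Field 𝕜 F (n + 1)) : Field 𝕜 F n :=
  fun x γ => weakStarMean (extendMean 𝕜 (𝔪 x)) fun g => f x (Fin.cons g γ)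

theorem IsInvariantSystemOfMeans.norm_meanHomotopy_le (h𝔪 : IsInvariantSystemOfMeans 𝒢 𝔪) {n : ℕ}
    {f : Field 𝕜 F (n + 1)} {x : X} {C : ℝ} (hf : ∀ γ, ‖f x γ‖ ≤ C) (γ : Fin n → Fib x) :
    ‖meanHomotopy 𝔪 f x γ‖ ≤ max C 0 := by
  have h := norm_weakStarMean_le (extendMean 𝕜 (𝔪 x)) (le_max_right C 0)
    (ae_of_all _ fun g => (hf (Fin.cons g γ)).trans (le_max_left C 0))
  refine h.trans (mul_le_of_le_one_left (le_max_right _ _) ?_)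
  exact (norm_extendMean_le _).trans (h𝔪.norm_eq_one x).le

theorem IsInvariantSystemOfMeans.extendMean_one (h𝔪 : IsInvariantSystemOfMeans 𝒢 𝔪) (x : X)
    {q : Lp 𝕜 ∞ (𝒢.ν x)} (hq : q =ᵐ[𝒢.ν x] fun _ => 1) : extendMean 𝕜 (𝔪 x) q = 1 := by
  have h1 : (RCLike.reCLM : StrongDual ℝ 𝕜).compLpL ∞ (𝒢.ν x) q =
      (BddBorel.one (Fib x)).toLinf (𝒢.ν x) := by
    refine Lp.ext ?_
    filter_upwards [hq, (RCLike.reCLM : StrongDual ℝ 𝕜).coeFn_compLpL q,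
      (BddBorel.one (Fib x)).coeFn_toLinf (𝒢.ν x)] with g h1 h2 h3
    rw [h2, h1, h3]
    simp [BddBorel.one]
  have h2 : (RCLike.reCLM : StrongDual ℝ 𝕜).compLpL ∞ (𝒢.ν x) ((RCLike.I : 𝕜) • q) = 0 := by
    refine Lp.ext ?_
    filter_upwards [hq, (RCLike.reCLM : StrongDual ℝ 𝕜).coeFn_compLpL ((RCLike.I : 𝕜) • q),
      Lp.coeFn_smul (RCLike.I : 𝕜) q, Lp.coeFn_zero ℝ ∞ (𝒢.ν x)] with g h1 h2 h3 h4
    rw [h2, h3, Pi.smul_apply, h1, h4]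
    simp
  rw [extendMean_apply, h1, h2, h𝔪.map_one, map_zero]
  simp

variable {ℱ : MeasurableGBundle 𝕜 𝒢 F} {n : ℕ} {f : Field 𝕜 F (n + 1)}

theorem IsLinfSection.exists_norm_le (hd : 𝒢.IsTDiscrete) {g : Field 𝕜 F n}
    (hf : IsLinfSection ℱ n g) (x : X) :
    ∃ C : ℝ, ∀ γ, ‖g x γ‖ ≤ C :=
  (hf.fibre x).2.imp fun _ hC => forall_of_ae (hd.ae_νPow _ x) hC

theorem IsLinfSection.isWeakStarLinf_cons [MeasurableSingletonClass (Arr X)]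
    (hd : 𝒢.IsTDiscrete) (hf : IsLinfSection ℱ (n + 1) f) (x : X) (γ : Fin n → Fib x) :
    IsWeakStarLinf 𝕜 (𝒢.ν x) fun g => f x (Fin.cons g γ) := by
  have := (hd x).1
  obtain ⟨C, hC⟩ := hf.exists_norm_le hd x
  exact isWeakStarLinf_of_forall fun g => hC _

theorem IsLinfSection.meanHomotopy [StandardBorelSpace (Arr X)] (hd : 𝒢.IsTDiscrete)
    (h𝔪 : IsInvariantSystemOfMeans 𝒢 𝔪) (hf : IsLinfSection ℱ (n + 1) f) :
    IsLinfSection ℱ n (meanHomotopy 𝔪 f) := by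
  have := MeasurableSpace.measurableSingletonClass_of_countablySeparated (α := Arr X)
  have hcount (x : X) : Countable (Fib x) := (hd x).1
  refine ⟨fun x => ?_, fun ξ hξ => ?_, ?_⟩
  · obtain ⟨C, hC⟩ := hf.exists_norm_le hd x
    exact isWeakStarLinf_of_forall (h𝔪.norm_meanHomotopy_le hC)
  · -- The pairing with `ξ` is the mean of the function `g ↦ ∫ ⟨f(g, γ), ξ(γ)⟩ dγ`.
    have hq (x : X) : ∃ q : Lp 𝕜 ∞ (𝒢.ν x),
        (∀ g, q g = ∫ γ, f x (Fin.cons g γ) (ξ x γ) ∂(𝒢.νPow n x)) ∧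
        extendMean 𝕜 (𝔪 x) q =
          ∫ γ, BddGroupoid.meanHomotopy 𝔪 f x γ (ξ x γ) ∂(𝒢.νPow n x) := by
      obtain ⟨C, hC⟩ := hf.exists_norm_le hd x
      exact exists_Linf_eq_integral (hd.ae_ν x) (extendMean 𝕜 (𝔪 x))
        (fun g γ => hC (Fin.cons g γ)) (ξ x)
    choose q hq hq' using hq
    obtain ⟨Φ, hΦ, h⟩ := exists_measurable_eq_on_fibres hd (φ := fun x g => q x g)
      (ae_of_all _ fun x => (Lp.memLp (q x)).integrable le_top) fun A hA => by
        simp only [hq, ← integral_prependIndicator (hf.fibre _) ξ hA]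
        exact hf.measurable _ (hξ.prependIndicator hA)
    simp only [← hq']
    refine h𝔪.aemeasurable_extendMean hΦ q ?_
    filter_upwards [h] with x hx using ae_of_all _ fun g => (hx g).symm
  · obtain ⟨C, hC⟩ := hf.essBounded
    refine ⟨max C 0, ?_⟩
    filter_upwards [hC] with x hx
    exact ae_of_all _ (h𝔪.norm_meanHomotopy_le (forall_of_ae (hd.ae_νPow _ x) hx))

theorem IsInvariant.meanHomotopy [MeasurableSingletonClass (Arr X)] (hd : 𝒢.IsTDiscrete)
    (h𝔪 : IsInvariantSystemOfMeans 𝒢 𝔪) (hf : IsLinfSection ℱ (n + 1) f)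
    (hinv : IsInvariant ℱ (n + 1) f) : IsInvariant ℱ n (meanHomotopy 𝔪 f) := by
  filter_upwards [hinv, h𝔪.extendMean_translate (𝕜 := 𝕜) hd] with g h1 h2
  refine ae_of_all _ fun γ => ContinuousLinearMap.ext fun v => ?_
  change weakStarMean _ _ v = weakStarMean _ _ (ℱ.act (Groupoid.inv g.hom) v)
  have hw := hf.isWeakStarLinf_cons hd g.tgt γ
  have hw' := hf.isWeakStarLinf_cons hd g.src
    fun i => Fib.translate (Groupoid.inv g.hom) (γ i)
  rw [weakStarMean_apply _ hw, weakStarMean_apply _ hw']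
  refine h2 _ _ fun h => ?_
  rw [forall_of_ae (hd.ae_ν _) (hw.memLp v).coeFn_toLp,
    forall_of_ae (hd.ae_ν _) (hw'.memLp _).coeFn_toLp]
  have h3 := forall_of_ae (hd.ae_νPow _ _) h1 (Fin.cons (Fib.translate g.hom h) γ)
  refine Eq.trans ?_ (congrArg (fun θ : StrongDual 𝕜 (F g.tgt) => θ v) h3.symm)
  change f g.src _ _ = f g.src _ _
  congr 2
  funext i
  refine Fin.cases ?_ (fun i => ?_) i
  · change h = Fib.translate _ (Fib.translate g.hom h)
    simp [Fib.translate]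
  · simp

theorem meanHomotopy_mem_cochains [StandardBorelSpace (Arr X)] (hd : 𝒢.IsTDiscrete)
    (h𝔪 : IsInvariantSystemOfMeans 𝒢 𝔪) {k : ℕ} {f : Field 𝕜 F (k + 2)}
    (hf : f ∈ cochains ℱ (k + 1)) : meanHomotopy 𝔪 f ∈ cochains ℱ k := by
  have := MeasurableSpace.measurableSingletonClass_of_countablySeparated (α := Arr X)
  exact ⟨hf.1.meanHomotopy hd h𝔪, hf.2.meanHomotopy hd h𝔪 hf.1⟩

/-- The homotopy identity on cocycles: `f(γ) = ∑ (-1)ⁱ f(g, γ₀, …, γ̂ᵢ, …)` holds for every `g` by the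
cocycle identity at `(g, γ)`, and the mean over `g` turns it into `f = d(hf)`. -/
theorem sub_coboundary_meanHomotopy_mem_nullFields [MeasurableSingletonClass (Arr X)]
    (hd : 𝒢.IsTDiscrete) (h𝔪 : IsInvariantSystemOfMeans 𝒢 𝔪) (hf : IsLinfSection ℱ (n + 1) f)
    (hcoc : coboundary f ∈ nullFields 𝕜 𝒢 F (n + 2)) :
    f - coboundary (meanHomotopy 𝔪 f) ∈ nullFields 𝕜 𝒢 F (n + 1) := by
  have hcoc' : ∀ᵐ x ∂𝒢.μ, ∀ᵐ γ ∂(𝒢.νPow (n + 2) x), coboundary f x γ = 0 := hcoc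
  change ∀ᵐ x ∂𝒢.μ, ∀ᵐ γ ∂(𝒢.νPow (n + 1) x), f x γ - coboundary (meanHomotopy 𝔪 f) x γ = 0
  filter_upwards [hcoc'] with x hx
  refine ae_of_all _ fun γ => sub_eq_zero.2 (ContinuousLinearMap.ext fun v => ?_)
  have hw (i : Fin (n + 1)) := hf.isWeakStarLinf_cons hd x fun j => γ (i.succAbove j)
  have hone : MemLp (fun _ : Fib x => (1 : 𝕜)) ∞ (𝒢.ν x) := memLp_const 1
  have hid (g : Fib x) : f x γ v =
      ∑ i : Fin (n + 1), (-1 : 𝕜) ^ (i : ℕ) * f x (Fin.cons g fun j => γ (i.succAbove j)) v := by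
    have h0 : ∑ i : Fin (n + 2), (-1 : 𝕜) ^ (i : ℕ) •
        f x (fun j => (Fin.cons g γ : Fin (n + 2) → Fib x) (i.succAbove j)) = 0 :=
      forall_of_ae (hd.ae_νPow _ x) hx (Fin.cons g γ)
    have h1 (i : Fin (n + 1)) : (fun j => (Fin.cons g γ : Fin (n + 2) → Fib x)
        (i.succ.succAbove j)) = Fin.cons g fun j => γ (i.succAbove j) := by
      funext j
      refine Fin.cases ?_ (fun j => ?_) j <;> simp
    have h2 : ∑ i : Fin (n + 2), (-1 : 𝕜) ^ (i : ℕ) *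
        f x (fun j => (Fin.cons g γ : Fin (n + 2) → Fib x) (i.succAbove j)) v = 0 :=
      (sum_apply ..).symm.trans (congrArg (fun θ : StrongDual 𝕜 (F x) => θ v) h0)
    rw [Fin.sum_univ_succ] at h2
    simp only [h1, Fin.val_zero, pow_zero, one_mul, Fin.zero_succAbove, Fin.cons_succ,
      Fin.val_succ, pow_succ, mul_neg, mul_one, neg_mul, Finset.sum_neg_distrib] at h2
    exact add_neg_eq_zero.1 h2
  have hLp : f x γ v • hone.toLp = ∑ i : Fin (n + 1), (-1 : 𝕜) ^ (i : ℕ) •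
      ((hw i).memLp v).toLp := by
    refine Lp.ext (ae_of_all _ fun g => ?_)
    have e : ∀ q : Lp 𝕜 ∞ (𝒢.ν x), q g = evalLinf 𝕜 (hd.ae_ν x) g q := fun _ => rfl
    rw [e, e, map_smul, map_sum]
    simp only [fun i : Fin (n + 1) => (evalLinf 𝕜 (hd.ae_ν x) g).map_smul ((-1) ^ (i : ℕ))
      ((hw i).memLp v).toLp, ← e, forall_of_ae (hd.ae_ν x) hone.coeFn_toLp g,
      fun i => forall_of_ae (hd.ae_ν x) ((hw i).memLp v).coeFn_toLp g, smul_eq_mul, mul_one]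
    exact hid g
  have h := congrArg (extendMean 𝕜 (𝔪 x)) hLp
  rw [map_smul, h𝔪.extendMean_one x hone.coeFn_toLp, smul_eq_mul, mul_one, map_sum] at h
  change _ = (∑ i : Fin (n + 1), (-1 : 𝕜) ^ (i : ℕ) •
    meanHomotopy 𝔪 f x fun j => γ (i.succAbove j)) v
  rw [h, sum_apply]
  refine Finset.sum_congr rfl fun i _ => ?_
  rw [map_smul, smul_apply, meanHomotopy, weakStarMean_apply _ (hw i)]

end Homotopy

end BddGroupoid

open BddGroupoid in
theorem corollaryB {𝕜 : Type*} [RCLike 𝕜]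
    {X : Type u} [CategoryTheory.Groupoid.{v} X] [MeasurableSpace X] [StandardBorelSpace X]
    [MeasurableSpace (Arr X)] [StandardBorelSpace (Arr X)] [BorelGroupoid X]
    (𝒢 : MeasuredGroupoid X) (hdiscrete : 𝒢.IsTDiscrete) (hamenable : 𝒢.IsAmenable)
    {F : X → Type w} [∀ x, NormedAddCommGroup (F x)] [∀ x, NormedSpace 𝕜 (F x)]
    (ℱ : MeasurableGBundle 𝕜 𝒢 F) (hseparable : ℱ.IsSeparable)
    (k : ℕ) (hk : 1 ≤ k) :
    Subsingleton (BoundedCohomology ℱ k) := by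
  obtain ⟨k, rfl⟩ := Nat.exists_eq_add_of_le' hk
  obtain ⟨𝔪, h𝔪⟩ := hamenable
  have := MeasurableSpace.measurableSingletonClass_of_countablySeparated (α := Arr X)
  rw [Submodule.subsingleton_iff_eq_bot, BoundedCohomology, eq_bot_iff,
    Submodule.map_le_iff_le_comap]
  rintro f ⟨hf, hcoc⟩
  refine (Submodule.Quotient.mk_eq_zero _).2 ⟨hf, Submodule.mem_sup.2 ⟨_,
    Submodule.mem_map_of_mem (meanHomotopy_mem_cochains hdiscrete h𝔪 hf), _,
    sub_coboundary_meanHomotopy_mem_nullFields hdiscrete h𝔪 hf.1 hcoc, add_sub_cancel _ _⟩⟩
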